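/- Let $\mathbb{X}$ be a finite set and let $\pi=(\pi(x_2\mid x_1))_{x_1,x_2\in\mathbb{X}}$ be an irreducible transition probability matrix. Let $X_1,X_2,\dots$ be a Markov chain with transition matrix $\pi$ and an arbitrary initial pmf $\mu$, and let $P_n(x^n)=\mu(x_1)\prod_{i=1}^{n-1}\pi(x_{i+1}\mid x_i)$ be the pmf of $X^n=(X_1,\dots,X_n)$. Let $\mathcal{M}_s(\mathbb{X}^2)$ be the set of pmfs $Q$ on $\mathbb{X}^2$ with $\sum_{x_1}Q(x_1,x)=\sum_{x_2}Q(x,x_2)$ for all $x$. Write $Q=q\times\eta$, where $q$ is the common marginal and $\eta(\cdot\mid x_1)=Q(x_1,\cdot)/q(x_1)$ if $q(x_1)\neq 0$, and $\eta(\cdot\mid x_1)$ is uniform otherwise. With natural logarithms and $0\cdot\infty=0$, put $$D(\eta\,\|\,\pi\mid q)=\sum_{x_1}q(x_1)\,D\big(\eta(\cdot\mid x_1)\,\|\,\pi(\cdot\mid x_1)\big)\in[0,\infty],\qquad H(\eta\mid q)=\sum_{x_1}q(x_1)\,H\big(\eta(\cdot\mid x_1)\big),$$ where $D$ is relative entropy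 and $H$ is Shannon entropy. A sequence of probability measures $\nu_n$ satisfies the LDP with rate function $I$ (values in $[0,\infty]$) if $I$ is lower semicontinuous with compact level sets, $\limsup_n \frac1n\ln\nu_n(K)\le-\inf_K I$ for every closed $K$, and $\liminf_n\frac1n\ln\nu_n(U)\ge-\inf_U I$ for every open $U$. (a) The distributions of the empirical pair measures $\frac1n\sum_{i=1}^n\delta_{(X_i,X_{i+1})}$ satisfy the LDP with rate function $I^{(2)}_\pi(Q)=D(\eta\,\|\,\pi\mid q)$ for $Q\in\mathcal{M}_s(\mathbb{X}^2)$, and $I^{(2)}_\pi(Q)=\infty$ for all other $Q$. (b) The distributions of the information spectrum $-\frac1n\ln P_n(X^n)$ satisfy the LDP on $\mathbb{R}$ with the contracted rate function $$I(t)=\inf\Big\{I^{(2)}_\pi(Q):\ Q\in\mathcal{M}_s(\mathbb{X}^2),\ \sum_{x_1,x_2}Q(x_1,x_2)\ln\frac1{\pi(x_2\mid x_1)}=t\Big\}.$$ (c) Let $\rho>0$, $\alpha=1/(1+\rho)$, $\beta=\rho/(1+\rho)$. The matrix with entries $\pi(x_2\mid x_1)^{\alpha}$ has a Perron–Frobenius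 eigenvalue $\lambda>0$: a real eigenvalue which is a simple root of the characteristic polynomial and is not exceeded in modulus by any complex eigenvalue. Moreover $$\lim_{n\to\infty}\frac1n\ln\mathbb{E}\Big[\exp\Big\{n\beta\cdot\Big(-\frac1n\ln P_n(X^n)\Big)\Big\}\Big]=\sup_{t\in\mathbb{R}}\{\beta t-I(t)\}=\ln\lambda .$$ If for every $n$ the map $G_n^*$ is an optimal guessing function for $P_n$, that is, a bijection of $\mathbb{X}^n$ onto $\{1,\dots,|\mathbb{X}|^n\}$ that guesses in decreasing order of $P_n$-probabilities (ties in any order), then the limiting guessing exponent exists and $$E(\rho)=\lim_{n\to\infty}\frac1n\ln\mathbb{E}\big[G_n^*(X^n)^\rho\big]=(1+\rho)\ln\lambda=\sup_{Q\in\mathcal{M}_s(\mathbb{X}^2)}\big\{\rho\,H(\eta\mid q)-D(\eta\,\|\,\pi\mid q)\big\}.$$ -/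

import Mathlib

open Filter Topology MeasureTheory
open scoped ENNReal NNReal

noncomputable section

namespace MarkovGuessing

/-- The joint pmf `P_n(x₁, …, x_n) = μ(x₁) π(x₂ ∣ x₁) ⋯ π(x_n ∣ x_{n-1})` of the first `n` letters
of the Markov chain with initial pmf `μ` and transition matrix `π`, where `π a b = π(b ∣ a)`. -/
def markovPmf {X : Type*} (μ : X → ℝ) (π : Matrix X X ℝ) : (n : ℕ) → (Fin n → X) → ℝ
  | 0, _ => 1
  | n + 1, x => μ (x 0) * ∏ i : Fin n, π (x i.castSucc) (x i.succ)

/-- The distribution of `f` when its argument has the pmf `p` on a finite set. -/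
def law {A S : Type*} [Fintype A] [MeasurableSpace S] (p : A → ℝ) (f : A → S) : Measure S :=
  ∑ a, ENNReal.ofReal (p a) • Measure.dirac (f a)

/-- The large deviation property of a sequence of measures, with rate function `I`. The infimum
over the empty set is `∞`, and `ln 0 = -∞`. -/
structure SatisfiesLDP {S : Type*} [TopologicalSpace S] [MeasurableSpace S]
    (ν : ℕ → Measure S) (I : S → ℝ≥0∞) : Prop where
  lowerSemicontinuous : LowerSemicontinuous I
  isCompact_level : ∀ c : ℝ≥0, IsCompact {s | I s ≤ c}
  upper : ∀ K : Set S, IsClosed K →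
    limsup (fun n : ℕ => ENNReal.log (ν n K) / (n : EReal)) atTop
      ≤ -((⨅ s ∈ K, I s : ℝ≥0∞) : EReal)
  lower : ∀ U : Set S, IsOpen U →
    -((⨅ s ∈ U, I s : ℝ≥0∞) : EReal)
      ≤ liminf (fun n : ℕ => ENNReal.log (ν n U) / (n : EReal)) atTop

/-- The information spectrum `-(1/n) ln P(x)` of a pmf `P` on words of length `n`. -/
def infoSpectrum {X : Type*} {n : ℕ} (P : (Fin n → X) → ℝ) (x : Fin n → X) : ℝ :=
  -Real.log (P x) / n

open Classical in
/-- The empirical pair measure `(1/n) ∑_{i=1}^n δ_{(x_i, x_{i+1})}` of a path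
with `n` transitions. -/
def pairEmpirical {X : Type*} {n : ℕ} (x : Fin (n + 1) → X) : X × X → ℝ :=
  fun ab => ((Finset.univ.filter fun i : Fin n => (x i.castSucc, x i.succ) = ab).card : ℝ) / n

/-- The set `M_s(X²)` of pmfs on `X × X` whose two marginals agree. -/
def stationaryPairs (X : Type*) [Fintype X] : Set (X × X → ℝ) :=
  {Q | Q ∈ stdSimplex ℝ (X × X) ∧ ∀ x, ∑ x₁, Q (x₁, x) = ∑ x₂, Q (x, x₂)}

/-- The first marginal `q` of `Q`. -/
def marginal {X : Type*} [Fintype X] (Q : X × X → ℝ) (x₁ : X) : ℝ := ∑ x₂, Q (x₁, x₂)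

open Classical in
/-- The conditional pmf `η(x₂ ∣ x₁)` of `Q = q × η`, uniform where `q(x₁) = 0`. -/
def condPmf {X : Type*} [Fintype X] (Q : X × X → ℝ) (x₁ x₂ : X) : ℝ :=
  if marginal Q x₁ ≠ 0 then Q (x₁, x₂) / marginal Q x₁ else 1 / Fintype.card X

/-- Shannon entropy (in nats) of a pmf. -/
def entropy {X : Type*} [Fintype X] (p : X → ℝ) : ℝ := -∑ x, p x * Real.log (p x)

open Classical in
/-- Relative entropy `D(p ‖ r)` of two pmfs; the sum is nonnegative for pmfs with `p ≪ r`,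
so that `ENNReal.ofReal` only changes its type. -/
def relEntropy {X : Type*} [Fintype X] (p r : X → ℝ) : ℝ≥0∞ :=
  if ∀ x, r x = 0 → p x = 0 then ENNReal.ofReal (∑ x, p x * Real.log (p x / r x)) else ⊤

/-- The conditional entropy `H(η ∣ q) = ∑ q(x₁) H(η(· ∣ x₁))`. -/
def condEntropy {X : Type*} [Fintype X] (Q : X × X → ℝ) : ℝ :=
  ∑ x₁, marginal Q x₁ * entropy (condPmf Q x₁)

/-- The conditional divergence `D(η ‖ π ∣ q) = ∑ q(x₁) D(η(· ∣ x₁) ‖ π(· ∣ x₁))`, with the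
convention `0 · ∞ = 0`. -/
def condRelEntropy {X : Type*} [Fintype X] (π : Matrix X X ℝ) (Q : X × X → ℝ) : ℝ≥0∞ :=
  ∑ x₁, ENNReal.ofReal (marginal Q x₁) * relEntropy (condPmf Q x₁) (π x₁)

open Classical in
/-- The level-2 rate function: `D(η ‖ π ∣ q)` on `M_s(X²)`, and `∞` elsewhere. -/
def levelTwoRate {X : Type*} [Fintype X] (π : Matrix X X ℝ) (Q : X × X → ℝ) : ℝ≥0∞ :=
  if Q ∈ stationaryPairs X then condRelEntropy π Q else ⊤

/-- The set `θ(t)` of those `Q ∈ M_s(X²)` with `∑ Q(x₁, x₂) ln (1 / π(x₂ ∣ x₁)) = t`. With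
`ln (1 / 0) = ∞` and `0 · ∞ = 0`, the sum is finite exactly if `Q` vanishes wherever `π` does. -/
def theta {X : Type*} [Fintype X] (π : Matrix X X ℝ) (t : ℝ) : Set (X × X → ℝ) :=
  {Q | Q ∈ stationaryPairs X ∧ (∀ x₁ x₂, π x₁ x₂ = 0 → Q (x₁, x₂) = 0) ∧
    ∑ x₁, ∑ x₂, Q (x₁, x₂) * Real.log (1 / π x₁ x₂) = t}

/-- The contracted rate function `I(t) = inf {I⁽²⁾(Q) : Q ∈ θ(t)}`. -/
def spectrumRate {X : Type*} [Fintype X] (π : Matrix X X ℝ) (t : ℝ) : ℝ≥0∞ :=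
  ⨅ Q ∈ theta π t, levelTwoRate π Q

/-- `r` is the Perron–Frobenius eigenvalue of `A`: a real eigenvalue, simple as a root of the
characteristic polynomial, that no complex eigenvalue exceeds in modulus. -/
structure IsPerronFrobeniusEigenvalue {X : Type*} [Fintype X] [DecidableEq X]
    (A : Matrix X X ℝ) (r : ℝ) : Prop where
  hasEigenvalue : Module.End.HasEigenvalue (Matrix.toLin' A) r
  simple : A.charpoly.rootMultiplicity r = 1
  dominant : ∀ z : ℂ,
    Module.End.HasEigenvalue (Matrix.toLin' (A.map (algebraMap ℝ ℂ))) z → ‖z‖ ≤ r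

/-- `G` is an optimal guessing function for `P`: a bijection onto `{1, …, |A|}` that guesses in the
decreasing order of `P`-probabilities (ties in any order). -/
def IsOptimalGuessing {A : Type*} [Fintype A] (P : A → ℝ) (G : A → ℕ) : Prop :=
  Set.BijOn G Set.univ (Set.Icc 1 (Fintype.card A)) ∧ ∀ a b, P b < P a → G a < G b

end MarkovGuessing

end

open MarkovGuessing

/-!
The rate `D(η ‖ π ∣ q)` of a pair measure `Q = q × η` supported by the positive entries of `π` is
the continuous function `pairRate π Q = ∑ Q ln Q - ∑ q ln q + ∑ Q ln (1 / π)`, and it is infinite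
for all other `Q`, so it is a good rate function on the compact set `M_s(X²)`.

*Level-2 upper bound* (`prob_le_of_le_pairRate`, `eventually_prob_le_exp`). The probability of a
word is a function of its first letter and its empirical pair measure `T`. Under the Markov chain
with the transition probabilities of `T` itself, the word is more probable by the factor
`exp (n D(T))`, so each of the polynomially many types has probability at most `exp (-n D(T))`.
Since the marginals of `T` differ by at most `1 / n`, all limit points of empirical pair measures lie in
`M_s(X²)`, and a compactness argument concludes.

*Level-2 lower bound* (`eventually_exp_le_prob_dist_lt`). A given `Q` is approximated by some `Q'`
that charges every possible transition. The chain with the conditional pmf of `Q'` is irreducible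
and follows `Q'` by the law of large numbers, which itself comes from the upper bound applied to
this chain: the rate vanishes only at the unique stationary pair measure. A change of measure
carries the estimate over to `π`.

*Information spectrum* (`satisfiesLDP_infoSpectrum`). On words of positive probability the
information spectrum is within `O(1 / n)` of the continuous function `energy π` of the empirical
pair measure, so both bounds are inherited, with the contracted rate function.

*Perron–Frobenius eigenvalue* (`exists_pos_eigenvectors`, `isPerronFrobeniusEigenvalue_of_pos`).
The entrywise power `π ^ α`, `α = 1 / (1 + ρ)`, has positive right and left eigenvectors `v`, `w`
for one eigenvalue `r`. The eigenvector `v` gives the growth rate `ln r` of `∑ P_n ^ α`, which is the exponential moment of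
the information spectrum, and Arikan's bounds (`IsOptimalGuessing.sum_mul_rpow_le`,
`IsOptimalGuessing.le_sum_mul_rpow`) turn it into the guessing exponent.

*Variational formulas*. By `pairRate_tilted`, the quantity `ln r - (H(η ∣ q) - α ∑ Q ln (1 / π))`
is the conditional divergence of `η` from the kernel `π(b ∣ a) ^ α v(b) / (r v(a))`. It is
nonnegative, and zero at the stationary pair measure of this kernel. Both suprema are rescalings
of this statement.
-/

namespace MarkovGuessing

/-! ### Perron–Frobenius theory of irreducible matrices -/

open Matrix in
/-- A nonnegative nonzero vector is mapped to a strictly positive one by a suitable sum of powers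
of an irreducible matrix. -/
lemma exists_sum_pow_pos {X : Type*} [Fintype X] [DecidableEq X] {A : Matrix X X ℝ}
    (hA : A.IsIrreducible) :
    ∃ N : ℕ, ∀ y : X → ℝ, 0 ≤ y → y ≠ 0 → ∀ i, 0 < ((∑ k ∈ Finset.range N, A ^ k) *ᵥ y) i := by
  have h := (Matrix.isIrreducible_iff_exists_pow_pos hA.nonneg).1 hA
  choose k hk hpos using h
  have hnn : ∀ m i j, 0 ≤ (A ^ m) i j := fun m => by
    induction m with
    | zero => intro i j; simp only [pow_zero, Matrix.one_apply]; split_ifs <;> norm_num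
    | succ m ih =>
      intro i j
      rw [pow_succ, Matrix.mul_apply]
      exact Finset.sum_nonneg fun l _ => mul_nonneg (ih i l) (hA.nonneg l j)
  refine ⟨(∑ i, ∑ j, k i j) + 1, fun y hy hy0 i => ?_⟩
  obtain ⟨j, hj⟩ := Function.ne_iff.1 hy0
  have hj : 0 < y j := lt_of_le_of_ne (hy j) (Ne.symm hj)
  have hentry : ∀ l, 0 ≤ (∑ m ∈ Finset.range ((∑ i, ∑ j, k i j) + 1), A ^ m) i l := fun l => by
    rw [Matrix.sum_apply]; exact Finset.sum_nonneg fun m _ => hnn m i l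
  refine Finset.sum_pos' (fun l _ => mul_nonneg (hentry l) (hy l)) ⟨j, Finset.mem_univ _, ?_⟩
  refine mul_pos ?_ hj
  beta_reduce
  rw [Matrix.sum_apply]
  refine Finset.sum_pos' (fun m _ => hnn m i j) ⟨k i j, ?_, hpos i j⟩
  rw [Finset.mem_range, Nat.lt_succ_iff]
  exact (Finset.single_le_sum (f := fun j => k i j) (fun _ _ => Nat.zero_le _)
    (Finset.mem_univ j)).trans (Finset.single_le_sum (f := fun i => ∑ j, k i j)
    (fun _ _ => Nat.zero_le _) (Finset.mem_univ i))

open Matrix in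
/-- A nonzero nonnegative eigenvector of an irreducible matrix is strictly positive. -/
lemma pos_of_eigenvector {X : Type*} [Fintype X] [DecidableEq X] {A : Matrix X X ℝ}
    (hA : A.IsIrreducible) {r : ℝ} {y : X → ℝ} (hy : 0 ≤ y) (hy0 : y ≠ 0)
    (h : A *ᵥ y = r • y) (i : X) : 0 < y i := by
  obtain ⟨N, hN⟩ := exists_sum_pow_pos hA
  have hp : ∀ k : ℕ, (A ^ k) *ᵥ y = r ^ k • y := fun k => by
    induction k with
    | zero => simp
    | succ k ih => rw [pow_succ, ← Matrix.mulVec_mulVec, h, Matrix.mulVec_smul, ih, smul_smul,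
        pow_succ, mul_comm]
  have := hN y hy hy0 i
  rw [Matrix.sum_mulVec, Finset.sum_congr rfl fun k _ => hp k, ← Finset.sum_smul,
    Pi.smul_apply, smul_eq_mul] at this
  exact lt_of_le_of_ne (hy i) fun h0 => by simp [← h0] at this

open Matrix in
/-- Existence of a positive eigenvector. The eigenvalue is the largest `r` such that
`r x ≤ A x` for some probability vector `x` (Collatz–Wielandt): if the inequality were not an
equality at the maximum, a positive sum of powers of `A` would make it strict in all coordinates,
and `r` could be enlarged. -/
theorem exists_pos_eigenvector {X : Type*} [Fintype X] [DecidableEq X] [Nonempty X]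
    {A : Matrix X X ℝ} (hA : A.IsIrreducible) :
    ∃ (r : ℝ) (v : X → ℝ), 0 < r ∧ (∀ i, 0 < v i) ∧ A *ᵥ v = r • v := by
  obtain ⟨N, hN⟩ := exists_sum_pow_pos hA
  set B := ∑ k ∈ Finset.range N, A ^ k with hB
  have hAB : A * B = B * A := by
    rw [hB, Finset.mul_sum, Finset.sum_mul]
    exact Finset.sum_congr rfl fun k _ => (pow_mul_comm' A k).symm
  let C : ℝ := ∑ i, ∑ j, A i j
  have hAx : ∀ x ∈ stdSimplex ℝ X, ∀ i, (A *ᵥ x) i ≤ ∑ j, A i j := fun x hx i =>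
    Finset.sum_le_sum fun j _ => mul_le_of_le_one_right (hA.nonneg i j)
      (hx.2 ▸ Finset.single_le_sum (f := x) (fun k _ => hx.1 k) (Finset.mem_univ j))
  have hAnn : ∀ x : X → ℝ, 0 ≤ x → 0 ≤ A *ᵥ x := fun x hx i =>
    Finset.sum_nonneg fun j _ => mul_nonneg (hA.nonneg i j) (hx j)
  let S : Set (ℝ × (X → ℝ)) :=
    (Set.Icc 0 C ×ˢ stdSimplex ℝ X) ∩ {p | ∀ i, p.1 * p.2 i ≤ (A *ᵥ p.2) i}
  have hScomp : IsCompact S := by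
    refine (isCompact_Icc.prod (isCompact_stdSimplex (𝕜 := ℝ) X)).inter_right ?_
    simp only [Set.ofPred_forall]
    refine isClosed_iInter fun i => isClosed_le (by fun_prop) ?_
    simp only [Matrix.mulVec, dotProduct]
    fun_prop
  have hC : 0 ≤ C := Finset.sum_nonneg fun i _ => Finset.sum_nonneg fun j _ => hA.nonneg i j
  have hne : S.Nonempty := by
    obtain ⟨i⟩ := ‹Nonempty X›
    have hx := single_mem_stdSimplex ℝ i
    exact ⟨(0, Pi.single i 1), ⟨⟨le_rfl, hC⟩, hx⟩, fun j => by
      rw [zero_mul]; exact hAnn _ (fun k => hx.1 k) j⟩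
  obtain ⟨⟨r, x⟩, ⟨⟨hr, hx⟩, hrx⟩, hmax⟩ := hScomp.exists_isMaxOn hne continuous_fst.continuousOn
  simp only [Set.mem_Icc] at hr hx
  have hx0 : x ≠ 0 := by rintro rfl; simpa using hx.2
  have heig : A *ᵥ x = r • x := by
    by_contra hcon
    -- `y` is positive and satisfies `r y < A y` in every coordinate
    set y := B *ᵥ x with hy
    have hypos : ∀ i, 0 < y i := hN x hx.1 hx0
    have hgap : ∀ i, 0 < (A *ᵥ y) i - r * y i := fun i => by
      have := hN (A *ᵥ x - r • x) (fun i => sub_nonneg.2 (hrx i)) (sub_ne_zero.2 hcon) i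
      rwa [Matrix.mulVec_sub, Matrix.mulVec_smul, Matrix.mulVec_mulVec, ← hAB,
        ← Matrix.mulVec_mulVec] at this
    obtain ⟨i₀, hi₀⟩ := Finite.exists_min fun i => ((A *ᵥ y) i - r * y i) / y i
    set ε := ((A *ᵥ y) i₀ - r * y i₀) / y i₀ with hε
    have hεpos : 0 < ε := div_pos (hgap i₀) (hypos i₀)
    set s := ∑ i, y i with hs
    have hspos : 0 < s := Finset.sum_pos (fun i _ => hypos i) Finset.univ_nonempty
    have hz : s⁻¹ • y ∈ stdSimplex ℝ X := ⟨fun i => (mul_pos (inv_pos.2 hspos) (hypos i)).le, by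
      simp only [Pi.smul_apply, smul_eq_mul]
      rw [← Finset.mul_sum, ← hs, inv_mul_cancel₀ hspos.ne']⟩
    have hzi : ∀ i, (r + ε) * (s⁻¹ • y) i ≤ (A *ᵥ (s⁻¹ • y)) i := fun i => by
      rw [Matrix.mulVec_smul]
      simp only [Pi.smul_apply, smul_eq_mul]
      have := hi₀ i
      rw [le_div_iff₀ (hypos i)] at this
      rw [mul_left_comm]
      exact mul_le_mul_of_nonneg_left (by linarith) (inv_pos.2 hspos).le
    have hle : r + ε ≤ C := by
      have h1 : ∑ i, (r + ε) * (s⁻¹ • y) i ≤ C :=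
        Finset.sum_le_sum fun i _ => (hzi i).trans (hAx _ hz i)
      rwa [← Finset.mul_sum, hz.2, mul_one] at h1
    have := hmax (show (r + ε, s⁻¹ • y) ∈ S from ⟨⟨⟨by linarith [hr.1], hle⟩, hz⟩, hzi⟩)
    simp only [Set.mem_ofPred_eq] at this
    linarith
  have hxpos := pos_of_eigenvector hA (fun i => hx.1 i) hx0 heig
  refine ⟨r, x, lt_of_le_of_ne hr.1 fun h0 => ?_, hxpos, heig⟩
  -- the eigenvalue is not zero, since some row has a positive entry
  obtain ⟨i⟩ := ‹Nonempty X›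
  have hz : ∀ j, A i j = 0 := fun j => by
    have h1 : (A *ᵥ x) i = 0 := by rw [heig, ← h0]; simp
    have h2 := (Finset.sum_eq_zero_iff_of_nonneg
      (fun j _ => mul_nonneg (hA.nonneg i j) (hxpos j).le)).1 h1 j (Finset.mem_univ j)
    exact (mul_eq_zero.1 h2).resolve_right (hxpos j).ne'
  obtain ⟨k, hk, hpos⟩ := (Matrix.isIrreducible_iff_exists_pow_pos hA.nonneg).1 hA i i
  obtain ⟨m, rfl⟩ := Nat.exists_eq_succ_of_ne_zero hk.ne'
  rw [pow_succ', Matrix.mul_apply] at hpos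
  simp [hz] at hpos

open Matrix in
/-- Subtracting the largest multiple of the positive eigenvector that leaves a nonnegative vector
gives a nonnegative eigenvector with a zero coordinate, which must vanish. -/
lemma eigenvector_eq_smul {X : Type*} [Fintype X] [DecidableEq X] [Nonempty X]
    {A : Matrix X X ℝ} (hA : A.IsIrreducible) {r : ℝ} {v x : X → ℝ} (hv : ∀ i, 0 < v i)
    (hAv : A *ᵥ v = r • v) (hx : A *ᵥ x = r • x) : ∃ t : ℝ, x = t • v := by
  obtain ⟨i₀, hi₀⟩ := Finite.exists_min fun i => x i / v i
  refine ⟨x i₀ / v i₀, ?_⟩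
  by_contra hne
  have hy : ∀ i, 0 ≤ (x - (x i₀ / v i₀) • v) i := fun i => by
    have := hi₀ i
    rw [le_div_iff₀ (hv i)] at this
    simpa using this
  have := pos_of_eigenvector (r := r) hA hy (sub_ne_zero.2 hne)
    (by rw [Matrix.mulVec_sub, Matrix.mulVec_smul, hAv, hx, smul_sub, smul_comm]) i₀
  simp [div_mul_cancel₀ _ (hv i₀).ne'] at this

open Matrix in
/-- An irreducible matrix has positive right and left eigenvectors for the same eigenvalue. -/
theorem exists_pos_eigenvectors {X : Type*} [Fintype X] [DecidableEq X] [Nonempty X]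
    {A : Matrix X X ℝ} (hA : A.IsIrreducible) :
    ∃ (r : ℝ) (v w : X → ℝ), 0 < r ∧ (∀ i, 0 < v i) ∧ (∀ i, 0 < w i) ∧
      A *ᵥ v = r • v ∧ w ᵥ* A = r • w := by
  obtain ⟨r, v, hr, hv, hAv⟩ := exists_pos_eigenvector hA
  obtain ⟨s, w, hs, hw, hAw⟩ := exists_pos_eigenvector hA.transpose
  rw [Matrix.mulVec_transpose] at hAw
  have hwv : 0 < w ⬝ᵥ v :=
    Finset.sum_pos (fun i _ => mul_pos (hw i) (hv i)) Finset.univ_nonempty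
  have : r = s := by
    have h := Matrix.dotProduct_mulVec w A v
    rw [hAv, hAw, dotProduct_smul, smul_dotProduct, smul_eq_mul, smul_eq_mul] at h
    exact mul_right_cancel₀ hwv.ne' h
  exact ⟨r, v, w, hr, hv, hw, hAv, this ▸ hAw⟩

open Matrix in
/-- A positive eigenvector belongs to the Perron–Frobenius eigenvalue. Algebraic simplicity holds
because the positive left eigenvector annihilates the range of `A - r`, so there are no generalized
eigenvectors of second order. -/
theorem isPerronFrobeniusEigenvalue_of_pos {X : Type*} [Fintype X] [DecidableEq X] [Nonempty X]
    {A : Matrix X X ℝ} (hA : A.IsIrreducible) {r : ℝ} {v w : X → ℝ}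
    (hv : ∀ i, 0 < v i) (hw : ∀ i, 0 < w i) (hAv : A *ᵥ v = r • v) (hwA : w ᵥ* A = r • w) :
    IsPerronFrobeniusEigenvalue A r := by
  have hv0 : v ≠ 0 := fun h => by
    obtain ⟨i⟩ := ‹Nonempty X›
    exact (hv i).ne' (congrFun h i)
  have hwv : 0 < w ⬝ᵥ v :=
    Finset.sum_pos (fun i _ => mul_pos (hw i) (hv i)) Finset.univ_nonempty
  refine ⟨?_, ?_, fun z hz => ?_⟩
  · exact Module.End.hasEigenvalue_of_hasEigenvector (x := v)
      ⟨Module.End.mem_eigenspace_iff.2 (by simpa using hAv), hv0⟩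
  · have hmax : Module.End.maxGenEigenspace (Matrix.toLin' A) r = ℝ ∙ v := by
      have hstep : ∀ x : X → ℝ, (∃ t : ℝ, A *ᵥ x - r • x = t • v) → A *ᵥ x - r • x = 0 := by
        rintro x ⟨t, ht⟩
        have h := congrArg (fun y => w ⬝ᵥ y) ht
        simp only [dotProduct_sub, dotProduct_smul, Matrix.dotProduct_mulVec, hwA,
          smul_dotProduct, sub_self, smul_eq_mul] at h
        have : t = 0 := (mul_eq_zero.1 h.symm).resolve_right hwv.ne'
        rw [ht, this, zero_smul]
      have hpow : ∀ (k : ℕ) (x : X → ℝ),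
          ((Matrix.toLin' A - algebraMap ℝ (Module.End ℝ (X → ℝ)) r) ^ k) x = 0 →
          ∃ t : ℝ, x = t • v := by
        intro k
        induction k with
        | zero => intro x hx; exact ⟨0, by simpa using hx⟩
        | succ k ih =>
          intro x hx
          rw [pow_succ, Module.End.mul_apply] at hx
          have h1 := ih _ hx
          simp only [LinearMap.sub_apply, Matrix.toLin'_apply, Module.algebraMap_end_apply] at h1
          exact eigenvector_eq_smul hA hv hAv (sub_eq_zero.1 (hstep x h1))
      ext x
      rw [Module.End.mem_maxGenEigenspace, Submodule.mem_span_singleton]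
      constructor
      · rintro ⟨k, hk⟩
        obtain ⟨t, ht⟩ := hpow k x (by simpa [Algebra.algebraMap_eq_smul_one] using hk)
        exact ⟨t, ht.symm⟩
      · rintro ⟨t, rfl⟩
        exact ⟨1, by simp [hAv]⟩
    rw [← Matrix.charpoly_toLin', ← LinearMap.finrank_maxGenEigenspace_eq, hmax,
      finrank_span_singleton hv0]
  · obtain ⟨u, hu, hu0⟩ := hz.exists_hasEigenvector
    rw [Module.End.mem_eigenspace_iff, Matrix.toLin'_apply] at hu
    have hle : ∀ i, ‖z‖ * ‖u i‖ ≤ (A *ᵥ fun j => ‖u j‖) i := fun i => by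
      have h := congrFun hu i
      rw [Pi.smul_apply, smul_eq_mul] at h
      rw [← norm_mul, ← h]
      refine (norm_sum_le _ _).trans (Finset.sum_le_sum fun j _ => ?_)
      simp [abs_of_nonneg (hA.nonneg i j)]
    have hpos : 0 < w ⬝ᵥ fun j => ‖u j‖ := by
      obtain ⟨i, hi⟩ := Function.ne_iff.1 hu0
      exact Finset.sum_pos' (fun j _ => mul_nonneg (hw j).le (norm_nonneg _))
        ⟨i, Finset.mem_univ i, mul_pos (hw i) (norm_pos_iff.2 hi)⟩
    have hsum : ‖z‖ * (w ⬝ᵥ fun j => ‖u j‖) ≤ r * (w ⬝ᵥ fun j => ‖u j‖) := by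
      have h1 : w ⬝ᵥ (fun i => ‖z‖ * ‖u i‖) ≤ w ⬝ᵥ (A *ᵥ fun j => ‖u j‖) :=
        Finset.sum_le_sum fun i _ => mul_le_mul_of_nonneg_left (hle i) (hw i).le
      rw [Matrix.dotProduct_mulVec, hwA, smul_dotProduct, smul_eq_mul] at h1
      calc _ = _ := (dotProduct_smul ‖z‖ w fun j => ‖u j‖).symm
        _ ≤ _ := h1
    exact le_of_mul_le_mul_right hsum hpos

/-! ### The conditional divergence as a real function -/

/-- `Q` is supported by the positive entries of `π`. -/
def IsSupported {X : Type*} (π : Matrix X X ℝ) (Q : X × X → ℝ) : Prop :=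
  ∀ x₁ x₂, π x₁ x₂ = 0 → Q (x₁, x₂) = 0

/-- The expected self-information `∑ Q(x₁, x₂) ln (1 / π(x₂ ∣ x₁))`. Terms with `π(x₂ ∣ x₁) = 0`
count as `0`, so the value is meaningful for supported `Q` only. -/
noncomputable def energy {X : Type*} [Fintype X] (π : Matrix X X ℝ) (Q : X × X → ℝ) : ℝ :=
  ∑ x₁, ∑ x₂, Q (x₁, x₂) * Real.log (1 / π x₁ x₂)

/-- The expression `∑ Q ln Q - ∑ q ln q + ∑ Q ln (1 / π)`, which is continuous on all of `ℝ^(X²)`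
and equals the conditional divergence `D(η ‖ π ∣ q)` of a supported `Q = q × η`. -/
noncomputable def pairRate {X : Type*} [Fintype X] (π : Matrix X X ℝ) (Q : X × X → ℝ) : ℝ :=
  ∑ x₁, ∑ x₂, Q (x₁, x₂) * Real.log (Q (x₁, x₂))
    - ∑ x₁, marginal Q x₁ * Real.log (marginal Q x₁) + energy π Q

section Rate

variable {X : Type*} [Fintype X]

lemma continuous_marginal (a : X) : Continuous fun Q : X × X → ℝ => marginal Q a := by
  unfold marginal; fun_prop

lemma continuous_energy (π : Matrix X X ℝ) : Continuous (energy π) := by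
  unfold energy; fun_prop

lemma continuous_pairRate (π : Matrix X X ℝ) : Continuous (pairRate π) := by
  unfold pairRate
  refine (Continuous.sub ?_ ?_).add (continuous_energy π)
  · exact continuous_finsetSum _ fun a _ => continuous_finsetSum _ fun b _ =>
      Real.continuous_mul_log.comp (continuous_apply (a, b))
  · exact continuous_finsetSum _ fun a _ => Real.continuous_mul_log.comp (continuous_marginal a)

lemma isClosed_isSupported {X : Type*} (π : Matrix X X ℝ) :
    IsClosed {Q : X × X → ℝ | IsSupported π Q} := by
  simp only [IsSupported, Set.ofPred_forall]
  exact isClosed_iInter fun a => isClosed_iInter fun b => isClosed_iInter fun _ =>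
    isClosed_eq (continuous_apply _) continuous_const

lemma isClosed_stationaryPairs : IsClosed (stationaryPairs X) := by
  have : stationaryPairs X = stdSimplex ℝ (X × X) ∩
      ⋂ x, {Q | ∑ x₁, Q (x₁, x) = ∑ x₂, Q (x, x₂)} := by
    ext Q; simp [stationaryPairs]
  rw [this]
  exact (isClosed_stdSimplex (𝕜 := ℝ) (X × X)).inter
    (isClosed_iInter fun a => isClosed_eq (by fun_prop) (by fun_prop))

/-- The effective domain of the rate function is compact. -/
lemma isCompact_stationaryPairs_inter_isSupported (π : Matrix X X ℝ) :
    IsCompact (stationaryPairs X ∩ {Q | IsSupported π Q}) :=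
  (isCompact_stdSimplex (𝕜 := ℝ) (X × X)).of_isClosed_subset
    (isClosed_stationaryPairs.inter (isClosed_isSupported π)) fun _ hQ => hQ.1.1

variable {Q : X × X → ℝ}

lemma marginal_nonneg (hQ : 0 ≤ Q) (a : X) : 0 ≤ marginal Q a :=
  Finset.sum_nonneg fun b _ => hQ (a, b)

lemma eq_zero_of_marginal_eq_zero (hQ : 0 ≤ Q) {a : X} (h : marginal Q a = 0) (b : X) :
    Q (a, b) = 0 :=
  (Finset.sum_eq_zero_iff_of_nonneg fun b _ => hQ (a, b)).1 h b (Finset.mem_univ b)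

lemma marginal_mul_condPmf (hQ : 0 ≤ Q) (a b : X) : marginal Q a * condPmf Q a b = Q (a, b) := by
  by_cases h : marginal Q a = 0
  · rw [h, zero_mul, eq_zero_of_marginal_eq_zero hQ h]
  · rw [condPmf, if_pos h, mul_div_cancel₀ _ h]

lemma condPmf_nonneg (hQ : 0 ≤ Q) (a b : X) : 0 ≤ condPmf Q a b := by
  unfold condPmf
  split_ifs
  · exact div_nonneg (hQ _) (marginal_nonneg hQ a)
  · positivity

lemma sum_condPmf (Q : X × X → ℝ) (a : X) : ∑ b, condPmf Q a b = 1 := by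
  have : Nonempty X := ⟨a⟩
  by_cases h : marginal Q a = 0
  · simp [condPmf, h]
  · simp only [condPmf, if_pos h, ne_eq, ← Finset.sum_div]
    exact div_self h

lemma condPmf_pos (hQ : 0 ≤ Q) {a b : X} (h : 0 < Q (a, b)) : 0 < condPmf Q a b := by
  have := marginal_mul_condPmf hQ a b
  refine lt_of_le_of_ne (condPmf_nonneg hQ a b) fun h0 => ?_
  rw [← h0, mul_zero] at this
  exact h.ne this

lemma mul_log_condPmf (hQ : 0 ≤ Q) (a b : X) :
    Q (a, b) * Real.log (condPmf Q a b)
      = Q (a, b) * Real.log (Q (a, b)) - Q (a, b) * Real.log (marginal Q a) := by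
  rcases (hQ (a, b)).eq_or_lt with h | h
  · simp [← h]
  · have hm : 0 < marginal Q a :=
      lt_of_le_of_ne (marginal_nonneg hQ a) fun h0 => h.ne'
        (eq_zero_of_marginal_eq_zero hQ h0.symm b)
    rw [condPmf, if_pos hm.ne', Real.log_div h.ne' hm.ne', mul_sub]

lemma condEntropy_eq (hQ : 0 ≤ Q) :
    condEntropy Q = -∑ a, ∑ b, Q (a, b) * Real.log (condPmf Q a b) := by
  unfold condEntropy entropy
  rw [← Finset.sum_neg_distrib]
  refine Finset.sum_congr rfl fun a _ => ?_
  rw [mul_neg, Finset.mul_sum]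
  simp only [← mul_assoc, marginal_mul_condPmf hQ]

lemma pairRate_eq_energy_sub_condEntropy (π : Matrix X X ℝ) (hQ : 0 ≤ Q) :
    pairRate π Q = energy π Q - condEntropy Q := by
  rw [condEntropy_eq hQ, pairRate]
  simp only [mul_log_condPmf hQ, Finset.sum_sub_distrib, ← Finset.sum_mul]
  simp only [marginal]
  ring

/-- Relative entropy as an `f`-divergence with a nonnegative integrand. -/
lemma sum_mul_log_div_eq_klFun {p r : X → ℝ} (hp : ∑ x, p x = 1) (hr : ∑ x, r x = 1)
    (h : ∀ x, r x = 0 → p x = 0) :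
    ∑ x, p x * Real.log (p x / r x) = ∑ x, r x * InformationTheory.klFun (p x / r x) := by
  have : ∀ x, r x * InformationTheory.klFun (p x / r x)
      = p x * Real.log (p x / r x) + r x - p x := fun x => by
    by_cases hx : r x = 0
    · simp [hx, h x hx]
    · rw [InformationTheory.klFun_apply]
      field_simp
  rw [Finset.sum_congr rfl fun x _ => this x, Finset.sum_sub_distrib, Finset.sum_add_distrib,
    hp, hr]
  ring

lemma sum_mul_log_div_nonneg {p r : X → ℝ} (hp0 : ∀ x, 0 ≤ p x) (hr0 : ∀ x, 0 ≤ r x)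
    (hp : ∑ x, p x = 1) (hr : ∑ x, r x = 1) (h : ∀ x, r x = 0 → p x = 0) :
    0 ≤ ∑ x, p x * Real.log (p x / r x) := by
  rw [sum_mul_log_div_eq_klFun hp hr h]
  exact Finset.sum_nonneg fun x _ =>
    mul_nonneg (hr0 x) (InformationTheory.klFun_nonneg (div_nonneg (hp0 x) (hr0 x)))

lemma eq_of_sum_mul_log_div_eq_zero {p r : X → ℝ} (hp0 : ∀ x, 0 ≤ p x) (hr0 : ∀ x, 0 ≤ r x)
    (hp : ∑ x, p x = 1) (hr : ∑ x, r x = 1) (h : ∀ x, r x = 0 → p x = 0)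
    (h0 : ∑ x, p x * Real.log (p x / r x) = 0) (x : X) : p x = r x := by
  rw [sum_mul_log_div_eq_klFun hp hr h] at h0
  have h1 := (Finset.sum_eq_zero_iff_of_nonneg fun x _ => mul_nonneg (hr0 x)
    (InformationTheory.klFun_nonneg (div_nonneg (hp0 x) (hr0 x)))).1 h0 x (Finset.mem_univ x)
  rcases mul_eq_zero.1 h1 with h2 | h2
  · rw [h x h2, h2]
  · rw [InformationTheory.klFun_eq_zero_iff (div_nonneg (hp0 x) (hr0 x))] at h2
    exact eq_of_div_eq_one h2

variable {π : Matrix X X ℝ}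

/-- The chain rule: the real rate is the average of the relative entropies of the rows. -/
lemma pairRate_eq_sum (hQ : 0 ≤ Q) (hs : IsSupported π Q) :
    pairRate π Q = ∑ a, marginal Q a *
      ∑ b, condPmf Q a b * Real.log (condPmf Q a b / π a b) := by
  rw [pairRate_eq_energy_sub_condEntropy π hQ, condEntropy_eq hQ, energy, sub_neg_eq_add,
    ← Finset.sum_add_distrib]
  refine Finset.sum_congr rfl fun a _ => ?_
  rw [← Finset.sum_add_distrib, Finset.mul_sum]
  refine Finset.sum_congr rfl fun b _ => ?_
  rw [← mul_assoc, marginal_mul_condPmf hQ]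
  rcases (hQ (a, b)).eq_or_lt with h | h
  · simp [← h]
  · have hπ : π a b ≠ 0 := fun h0 => h.ne' (hs a b h0)
    rw [Real.log_div (condPmf_pos hQ h).ne' hπ, one_div, Real.log_inv]
    ring

lemma condPmf_eq_zero_of_isSupported (hs : IsSupported π Q) {a : X} (ha : marginal Q a ≠ 0)
    (b : X) (h : π a b = 0) : condPmf Q a b = 0 := by
  rw [condPmf, if_pos ha, hs a b h, zero_div]

lemma marginal_mul_divergence_nonneg [DecidableEq X] (hπ : π ∈ Matrix.rowStochastic ℝ X)
    (hQ : 0 ≤ Q) (hs : IsSupported π Q) (a : X) :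
    0 ≤ marginal Q a * ∑ b, condPmf Q a b * Real.log (condPmf Q a b / π a b) := by
  by_cases ha : marginal Q a = 0
  · simp [ha]
  · exact mul_nonneg (marginal_nonneg hQ a) (sum_mul_log_div_nonneg (condPmf_nonneg hQ a)
      (hπ.1 a) (sum_condPmf Q a) (Matrix.sum_row_of_mem_rowStochastic hπ a)
      (condPmf_eq_zero_of_isSupported hs ha))

lemma pairRate_nonneg [DecidableEq X] (hπ : π ∈ Matrix.rowStochastic ℝ X) (hQ : 0 ≤ Q)
    (hs : IsSupported π Q) :
    0 ≤ pairRate π Q := by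
  rw [pairRate_eq_sum hQ hs]
  exact Finset.sum_nonneg fun a _ => marginal_mul_divergence_nonneg hπ hQ hs a

/-- The rate vanishes only where the conditional pmf is `π`. -/
lemma eq_mul_of_pairRate_eq_zero [DecidableEq X] (hπ : π ∈ Matrix.rowStochastic ℝ X) (hQ : 0 ≤ Q)
    (hs : IsSupported π Q) (h : pairRate π Q = 0) (a b : X) : Q (a, b) = marginal Q a * π a b := by
  rw [pairRate_eq_sum hQ hs] at h
  have h1 := (Finset.sum_eq_zero_iff_of_nonneg
    fun a _ => marginal_mul_divergence_nonneg hπ hQ hs a).1 h a (Finset.mem_univ a)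
  rcases mul_eq_zero.1 h1 with h2 | h2
  · rw [eq_zero_of_marginal_eq_zero hQ h2, h2, zero_mul]
  · by_cases ha : marginal Q a = 0
    · rw [eq_zero_of_marginal_eq_zero hQ ha, ha, zero_mul]
    rw [← eq_of_sum_mul_log_div_eq_zero (condPmf_nonneg hQ a)
      (hπ.1 a) (sum_condPmf Q a) (Matrix.sum_row_of_mem_rowStochastic hπ a)
      (condPmf_eq_zero_of_isSupported hs ha) h2 b, marginal_mul_condPmf hQ]

lemma condRelEntropy_eq_ofReal [DecidableEq X] (hπ : π ∈ Matrix.rowStochastic ℝ X) (hQ : 0 ≤ Q)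
    (hs : IsSupported π Q) : condRelEntropy π Q = ENNReal.ofReal (pairRate π Q) := by
  rw [pairRate_eq_sum hQ hs, ENNReal.ofReal_sum_of_nonneg
    fun a _ => marginal_mul_divergence_nonneg hπ hQ hs a]
  refine Finset.sum_congr rfl fun a _ => ?_
  by_cases ha : marginal Q a = 0
  · simp [ha]
  · rw [relEntropy, if_pos (condPmf_eq_zero_of_isSupported hs ha),
      ENNReal.ofReal_mul (marginal_nonneg hQ a)]

lemma condRelEntropy_eq_top (hQ : 0 ≤ Q) (hs : ¬ IsSupported π Q) : condRelEntropy π Q = ⊤ := by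
  simp only [IsSupported, not_forall] at hs
  obtain ⟨a, b, hab, h⟩ := hs
  have hpos : 0 < Q (a, b) := lt_of_le_of_ne (hQ _) (Ne.symm h)
  have ha : 0 < marginal Q a := lt_of_le_of_ne (marginal_nonneg hQ a) fun h0 =>
    h (eq_zero_of_marginal_eq_zero hQ h0.symm b)
  refine ENNReal.sum_eq_top.2 ⟨a, Finset.mem_univ a, ?_⟩
  rw [relEntropy, if_neg (fun hall => (condPmf_pos hQ hpos).ne' (hall b hab)), ENNReal.mul_top]
  exact (ENNReal.ofReal_pos.2 ha).ne'

lemma levelTwoRate_eq_ofReal [DecidableEq X] (hπ : π ∈ Matrix.rowStochastic ℝ X)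
    (hQ : Q ∈ stationaryPairs X) (hs : IsSupported π Q) :
    levelTwoRate π Q = ENNReal.ofReal (pairRate π Q) := by
  rw [levelTwoRate, if_pos hQ, condRelEntropy_eq_ofReal hπ hQ.1.1 hs]

lemma levelTwoRate_eq_top (h : ¬ (Q ∈ stationaryPairs X ∧ IsSupported π Q)) :
    levelTwoRate π Q = ⊤ := by
  rw [levelTwoRate]
  split_ifs with hQ
  · exact condRelEntropy_eq_top hQ.1.1 fun hs => h ⟨hQ, hs⟩
  · rfl

/-! ### The Gibbs variational principle -/

/-- For stationary `Q` the terms `∑ Q(a, b) (ln v(b) - ln v(a))` cancel, so that replacing `π` by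
`π(b ∣ a) ^ α v(b) / (r v(a))` in the rate leaves `ln r - (H(η ∣ q) - α ∑ Q ln (1 / π))`. If `v` is an
eigenvector of the entrywise power `π ^ α` with eigenvalue `r`, the new matrix is stochastic, and
its rate is a conditional divergence. -/
lemma pairRate_tilted {α r : ℝ} {v : X → ℝ} (hr : 0 < r) (hv : ∀ i, 0 < v i)
    (hπ0 : ∀ a b, 0 ≤ π a b)
    (hQ : Q ∈ stationaryPairs X) (hs : IsSupported π Q) :
    pairRate (Matrix.of fun a b => π a b ^ α * v b / (r * v a)) Q
      = Real.log r - (condEntropy Q - α * energy π Q) := by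
  rw [pairRate_eq_energy_sub_condEntropy _ hQ.1.1]
  have hterm : ∀ a b, Q (a, b) * Real.log (1 / (π a b ^ α * v b / (r * v a)))
      = α * (Q (a, b) * Real.log (1 / π a b)) + Q (a, b) * Real.log r
        + (Q (a, b) * Real.log (v a) - Q (a, b) * Real.log (v b)) := fun a b => by
    rcases (hQ.1.1 (a, b)).eq_or_lt with h | h
    · simp [← h]
    · have hπ : 0 < π a b := lt_of_le_of_ne (hπ0 a b) fun h0 => h.ne' (hs a b h0.symm)
      rw [one_div, Real.log_inv, Real.log_div (mul_pos (Real.rpow_pos_of_pos hπ _) (hv b)).ne'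
        (mul_pos hr (hv a)).ne', Real.log_mul (Real.rpow_pos_of_pos hπ _).ne' (hv b).ne',
        Real.log_mul hr.ne' (hv a).ne', Real.log_rpow hπ, one_div, Real.log_inv]
      ring
  have hsum : ∑ a, ∑ b, Q (a, b) = 1 := by rw [← Fintype.sum_prod_type', ← hQ.1.2]
  have hflip : ∑ a, ∑ b, Q (a, b) * Real.log (v b) = ∑ a, ∑ b, Q (a, b) * Real.log (v a) := by
    rw [Finset.sum_comm]
    simp only [← Finset.sum_mul, hQ.2]
  simp only [energy, Matrix.of_apply, hterm, Finset.sum_add_distrib, Finset.sum_sub_distrib,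
    ← Finset.mul_sum, hflip]
  simp only [← Finset.sum_mul, hsum]
  ring

lemma tilted_mem_rowStochastic [DecidableEq X] {A : Matrix X X ℝ} (hA : ∀ a b, 0 ≤ A a b)
    {r : ℝ} {v : X → ℝ} (hr : 0 < r) (hv : ∀ i, 0 < v i) (hAv : A.mulVec v = r • v) :
    (Matrix.of fun a b => A a b * v b / (r * v a)) ∈ Matrix.rowStochastic ℝ X := by
  rw [Matrix.mem_rowStochastic_iff_sum]
  refine ⟨fun a b => div_nonneg (mul_nonneg (hA a b) (hv b).le) (mul_pos hr (hv a)).le,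
    fun a => ?_⟩
  simp only [Matrix.of_apply]
  rw [← Finset.sum_div, div_eq_one_iff_eq (mul_pos hr (hv a)).ne']
  exact congrFun hAv a

/-- For a right eigenvector `v` and a left eigenvector `w` of `A` with eigenvalue `r`, the pair
measure of the stationary Markov chain with transition probabilities `A a b v b / (r v a)`. -/
noncomputable def tiltedPair (A : Matrix X X ℝ) (r : ℝ) (v w : X → ℝ) (ab : X × X) : ℝ :=
  w ab.1 * A ab.1 ab.2 * v ab.2 / (r * ∑ i, w i * v i)

lemma tiltedPair_pos [Nonempty X] {A : Matrix X X ℝ} {r : ℝ} {v w : X → ℝ} (hr : 0 < r)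
    (hv : ∀ i, 0 < v i) (hw : ∀ i, 0 < w i) {a b : X} (h : 0 < A a b) :
    0 < tiltedPair A r v w (a, b) :=
  div_pos (mul_pos (mul_pos (hw a) h) (hv b))
    (mul_pos hr (Finset.sum_pos (fun i _ => mul_pos (hw i) (hv i)) Finset.univ_nonempty))

lemma marginal_tiltedPair [Nonempty X] {A : Matrix X X ℝ} {r : ℝ} {v w : X → ℝ} (hr : 0 < r)
    (hAv : A.mulVec v = r • v) (a : X) :
    marginal (tiltedPair A r v w) a = w a * v a / ∑ i, w i * v i := by
  have h : ∑ b, A a b * v b = r * v a := congrFun hAv a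
  simp only [marginal, tiltedPair, mul_assoc, ← Finset.sum_div, ← Finset.mul_sum, h]
  rw [mul_left_comm, mul_div_mul_left _ _ hr.ne']

lemma tiltedPair_mem_stationaryPairs [Nonempty X] {A : Matrix X X ℝ} (hA : ∀ a b, 0 ≤ A a b)
    {r : ℝ} {v w : X → ℝ} (hr : 0 < r) (hv : ∀ i, 0 < v i) (hw : ∀ i, 0 < w i)
    (hAv : A.mulVec v = r • v) (hwA : Matrix.vecMul w A = r • w) :
    tiltedPair A r v w ∈ stationaryPairs X := by
  have hs : 0 < ∑ i, w i * v i :=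
    Finset.sum_pos (fun i _ => mul_pos (hw i) (hv i)) Finset.univ_nonempty
  refine ⟨⟨fun ab => div_nonneg (mul_nonneg (mul_nonneg (hw _).le (hA _ _)) (hv _).le)
    (mul_pos hr hs).le, ?_⟩, fun b => ?_⟩
  · rw [Fintype.sum_prod_type]
    change ∑ a, marginal (tiltedPair A r v w) a = 1
    simp only [marginal_tiltedPair hr hAv]
    rw [← Finset.sum_div, div_self hs.ne']
  · have h1 := marginal_tiltedPair (w := w) hr hAv b
    have h2 : ∑ a, w a * A a b = r * w b := congrFun hwA b
    rw [marginal] at h1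
    rw [h1]
    simp only [tiltedPair, ← Finset.sum_div, ← Finset.sum_mul, h2]
    rw [mul_assoc, mul_div_mul_left _ _ hr.ne']

lemma condEntropy_sub_energy_le [DecidableEq X] {α r : ℝ} {v : X → ℝ} (hr : 0 < r)
    (hv : ∀ i, 0 < v i) (hα : α ≠ 0) (hπ0 : ∀ a b, 0 ≤ π a b)
    (hAv : (Matrix.of fun a b => π a b ^ α).mulVec v = r • v)
    (hQ : Q ∈ stationaryPairs X) (hs : IsSupported π Q) :
    condEntropy Q - α * energy π Q ≤ Real.log r := by
  have h := pairRate_nonneg (tilted_mem_rowStochastic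
    (A := Matrix.of fun a b => π a b ^ α) (fun a b => Real.rpow_nonneg (hπ0 a b) _) hr hv hAv)
    hQ.1.1 (fun a b h => hs a b ?_)
  · simp only [Matrix.of_apply] at h
    rw [pairRate_tilted hr hv hπ0 hQ hs] at h
    linarith
  · have h1 : π a b ^ α = 0 := by
      have := (div_eq_zero_iff.1 h).resolve_right (mul_pos hr (hv a)).ne'
      exact (mul_eq_zero.1 this).resolve_right (hv b).ne'
    exact (Real.rpow_eq_zero (hπ0 a b) hα).1 h1

lemma isSupported_tiltedPair_rpow {α : ℝ} (hα : α ≠ 0) (r : ℝ) (v w : X → ℝ) :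
    IsSupported π (tiltedPair (Matrix.of fun a b => π a b ^ α) r v w) := fun a b h => by
  simp [tiltedPair, h, Real.zero_rpow hα]

/-- Equality in the variational principle at the stationary pair measure of the tilted kernel. -/
lemma condEntropy_sub_energy_tiltedPair [Nonempty X] {α r : ℝ} {v w : X → ℝ} (hr : 0 < r)
    (hv : ∀ i, 0 < v i) (hw : ∀ i, 0 < w i) (hα : α ≠ 0) (hπ0 : ∀ a b, 0 ≤ π a b)
    (hAv : (Matrix.of fun a b => π a b ^ α).mulVec v = r • v)
    (hwA : Matrix.vecMul w (Matrix.of fun a b => π a b ^ α) = r • w) :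
    condEntropy (tiltedPair (Matrix.of fun a b => π a b ^ α) r v w)
      - α * energy π (tiltedPair (Matrix.of fun a b => π a b ^ α) r v w) = Real.log r := by
  set A : Matrix X X ℝ := Matrix.of fun a b => π a b ^ α with hAdef
  set Q := tiltedPair A r v w with hQdef
  have hA0 : ∀ a b, 0 ≤ A a b := fun a b => Real.rpow_nonneg (hπ0 a b) _
  have hs := isSupported_tiltedPair_rpow (π := π) hα r v w
  have hQ : Q ∈ stationaryPairs X := tiltedPair_mem_stationaryPairs hA0 hr hv hw hAv hwA
  have hwv : 0 < ∑ i, w i * v i :=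
    Finset.sum_pos (fun i _ => mul_pos (hw i) (hv i)) Finset.univ_nonempty
  have h := pairRate_tilted (α := α) hr hv hπ0 hQ hs
  have h0 : pairRate (Matrix.of fun a b => π a b ^ α * v b / (r * v a)) Q = 0 := by
    rw [pairRate_eq_energy_sub_condEntropy _ hQ.1.1, condEntropy_eq hQ.1.1, energy,
      sub_neg_eq_add, ← Finset.sum_add_distrib]
    refine Finset.sum_eq_zero fun a _ => ?_
    rw [← Finset.sum_add_distrib]
    refine Finset.sum_eq_zero fun b _ => ?_
    have hm := marginal_tiltedPair (w := w) hr hAv a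
    have hmpos : 0 < w a * v a / ∑ i, w i * v i := div_pos (mul_pos (hw a) (hv a)) hwv
    have hc : condPmf Q a b = π a b ^ α * v b / (r * v a) := by
      rw [condPmf, if_pos (by rw [hm]; exact hmpos.ne'), hm, hQdef, tiltedPair, hAdef]
      have := (hw a).ne'
      have := (hv a).ne'
      have := hwv.ne'
      simp only [Matrix.of_apply]
      field_simp
    rw [hc, Matrix.of_apply, one_div, Real.log_inv]
    ring
  linarith

end Rate

/-! ### Word probabilities and types -/

/-- The probability `∑_{a ∈ s} p(a)` of a set under a pmf. -/
noncomputable def prob {A : Type*} [Fintype A] (p : A → ℝ) (s : Set A) : ℝ := ∑ a, s.indicator p a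

section Prob

variable {A : Type*} [Fintype A] {p : A → ℝ}

lemma prob_mono (hp : 0 ≤ p) {s t : Set A} (h : ∀ a ∈ s, 0 < p a → a ∈ t) :
    prob p s ≤ prob p t := by
  refine Finset.sum_le_sum fun a _ => ?_
  by_cases hs : a ∈ s
  · rcases (hp a).eq_or_lt with h0 | h0
    · have h0 : p a = 0 := h0.symm
      rw [Set.indicator_of_mem hs, h0]
      exact Set.indicator_nonneg (fun a _ => hp a) a
    · rw [Set.indicator_of_mem hs, Set.indicator_of_mem (h a hs h0)]
  · rw [Set.indicator_of_notMem hs]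
    exact Set.indicator_nonneg (fun a _ => hp a) a

lemma prob_add_prob_compl (p : A → ℝ) (s : Set A) : prob p s + prob p sᶜ = ∑ a, p a := by
  rw [prob, prob, ← Finset.sum_add_distrib]
  exact Finset.sum_congr rfl fun a _ => congrFun (Set.indicator_self_add_compl s p) a

end Prob

section Words

variable {X : Type*}

lemma markovPmf_nonneg {μ : X → ℝ} {π : Matrix X X ℝ} (hμ : 0 ≤ μ) (hπ : ∀ a b, 0 ≤ π a b)
    (n : ℕ) : 0 ≤ markovPmf μ π n := fun x => by
  cases n with
  | zero => exact zero_le_one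
  | succ n => exact mul_nonneg (hμ _) (Finset.prod_nonneg fun i _ => hπ _ _)

lemma pos_of_markovPmf_pos {μ : X → ℝ} {π : Matrix X X ℝ} (hμ : 0 ≤ μ) (hπ : ∀ a b, 0 ≤ π a b)
    {n : ℕ} {x : Fin (n + 1) → X} (h : 0 < markovPmf μ π (n + 1) x) :
    0 < μ (x 0) ∧ ∀ i : Fin n, 0 < π (x i.castSucc) (x i.succ) := by
  have h' : μ (x 0) * ∏ i : Fin n, π (x i.castSucc) (x i.succ) ≠ 0 := h.ne'
  rw [mul_ne_zero_iff, Finset.prod_ne_zero_iff] at h'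
  exact ⟨lt_of_le_of_ne (hμ _) h'.1.symm,
    fun i => lt_of_le_of_ne (hπ _ _) (h'.2 i (Finset.mem_univ i)).symm⟩

lemma markovPmf_cons (m : X → ℝ) (A : Matrix X X ℝ) (n : ℕ) (a : X) (x : Fin (n + 1) → X) :
    markovPmf m A (n + 2) (Fin.cons a x) = m a * markovPmf (A a) A (n + 1) x := by
  simp only [markovPmf, Fin.cons_zero, Fin.prod_univ_succ]
  simp

/-- Summation over the last letters of all words, against an eigenvector of the transition
matrix. -/
lemma sum_markovPmf_mul_eigenvector [Fintype X] {A : Matrix X X ℝ} {v : X → ℝ} {r : ℝ}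
    (hAv : A.mulVec v = r • v) (n : ℕ) (m : X → ℝ) :
    ∑ x : Fin (n + 1) → X, markovPmf m A (n + 1) x * v (x (Fin.last n))
      = r ^ n * ∑ a, m a * v a := by
  induction n generalizing m with
  | zero =>
    rw [pow_zero, one_mul, ← (Equiv.funUnique (Fin 1) X).symm.sum_comp]
    simp [markovPmf]
  | succ n ih =>
    rw [← (Fin.consEquiv fun _ : Fin (n + 2) => X).sum_comp, Fintype.sum_prod_type, Finset.mul_sum]
    refine Finset.sum_congr rfl fun a _ => ?_
    have h : ∑ b, A a b * v b = r * v a := congrFun hAv a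
    simp only [Fin.consEquiv_apply]
    calc _ = m a * ∑ x : Fin (n + 1) → X,
          markovPmf (A a) A (n + 1) x * v (x (Fin.last n)) := by
          rw [Finset.mul_sum]
          refine Finset.sum_congr rfl fun x _ => ?_
          change markovPmf m A (n + 2) (Fin.cons a x)
            * v ((Fin.cons a x : Fin (n + 2) → X) (Fin.last n).succ) = _
          rw [markovPmf_cons, Fin.cons_succ, mul_assoc]
      _ = _ := by rw [ih, h, pow_succ]; ring

variable [Fintype X]

lemma sum_markovPmf [DecidableEq X] {μ : X → ℝ} {π : Matrix X X ℝ} (hμ : μ ∈ stdSimplex ℝ X)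
    (hπ : π ∈ Matrix.rowStochastic ℝ X) (n : ℕ) : ∑ x, markovPmf μ π n x = 1 := by
  cases n with
  | zero => simp [markovPmf]
  | succ n =>
    have := sum_markovPmf_mul_eigenvector (A := π) (v := 1) (r := 1) (by rw [hπ.2, one_smul]) n μ
    simpa [hμ.2] using this

lemma pairEmpirical_nonneg {X : Type*} {n : ℕ} (x : Fin (n + 1) → X) : 0 ≤ pairEmpirical x :=
  fun _ => by unfold pairEmpirical; positivity

lemma sum_pairEmpirical_mul {n : ℕ} (x : Fin (n + 1) → X) (f : X × X → ℝ) :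
    n * ∑ p, pairEmpirical x p * f p = ∑ i : Fin n, f (x i.castSucc, x i.succ) := by
  classical
  rcases Nat.eq_zero_or_pos n with rfl | hn
  · simp
  have hn : (n : ℝ) ≠ 0 := by positivity
  rw [← Finset.sum_fiberwise Finset.univ (fun i : Fin n => (x i.castSucc, x i.succ)),
    Finset.mul_sum]
  refine Finset.sum_congr rfl fun p _ => ?_
  rw [Finset.sum_congr rfl fun i hi => congrArg f (Finset.mem_filter.1 hi).2, Finset.sum_const,
    nsmul_eq_mul, pairEmpirical, ← mul_assoc, mul_div_cancel₀ _ hn]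

lemma pairEmpirical_pos {X : Type*} {n : ℕ} (x : Fin (n + 1) → X) (i : Fin n) :
    0 < pairEmpirical x (x i.castSucc, x i.succ) := by
  have hn : 0 < n := i.pos
  refine div_pos ?_ (by positivity)
  exact_mod_cast Finset.card_pos.2 ⟨i, by simp⟩

lemma pairEmpirical_mem_stdSimplex {n : ℕ} (hn : n ≠ 0) (x : Fin (n + 1) → X) :
    pairEmpirical x ∈ stdSimplex ℝ (X × X) := by
  refine ⟨fun p => pairEmpirical_nonneg x p, ?_⟩
  have := sum_pairEmpirical_mul x fun _ => 1
  have hn : (n : ℝ) ≠ 0 := by positivity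
  simpa [hn] using this

/-- The two marginals of the empirical pair measure differ only by the end letters of the word. -/
lemma abs_marginal_sub_le {n : ℕ} (x : Fin (n + 1) → X) (c : X) :
    n * |∑ a, pairEmpirical x (a, c) - ∑ b, pairEmpirical x (c, b)| ≤ 1 := by
  classical
  have h1 := sum_pairEmpirical_mul x fun p => if p.2 = c then 1 else 0
  have h2 := sum_pairEmpirical_mul x fun p => if p.1 = c then 1 else 0
  have e1 : ∑ p : X × X, pairEmpirical x p * (if p.2 = c then 1 else 0)
      = ∑ a, pairEmpirical x (a, c) := by rw [Fintype.sum_prod_type]; simp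
  have e2 : ∑ p : X × X, pairEmpirical x p * (if p.1 = c then 1 else 0)
      = ∑ b, pairEmpirical x (c, b) := by rw [Fintype.sum_prod_type_right]; simp
  rw [e1] at h1
  rw [e2] at h2
  have h3 :=
    (Fin.sum_univ_castSucc fun i : Fin (n + 1) => if x i = c then (1 : ℝ) else 0).symm.trans
    (Fin.sum_univ_succ fun i : Fin (n + 1) => if x i = c then (1 : ℝ) else 0)
  have h4 : (n : ℝ) * (∑ a, pairEmpirical x (a, c) - ∑ b, pairEmpirical x (c, b))
      = (if x (Fin.last n) = c then (1 : ℝ) else 0) - (if x 0 = c then (1 : ℝ) else 0) := by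
    rw [mul_sub, h1, h2]
    dsimp only
    linarith
  rw [← abs_of_nonneg (Nat.cast_nonneg (α := ℝ) n), ← abs_mul, h4]
  split_ifs <;> norm_num

/-- The probability of a word depends on its initial letter and its empirical pair measure. -/
lemma prod_eq_exp_energy {n : ℕ} (x : Fin (n + 1) → X) (κ : Matrix X X ℝ)
    (h : ∀ i : Fin n, 0 < κ (x i.castSucc) (x i.succ)) :
    ∏ i : Fin n, κ (x i.castSucc) (x i.succ) = Real.exp (-(n * energy κ (pairEmpirical x))) := by
  rw [energy, ← Fintype.sum_prod_type' fun a b => pairEmpirical x (a, b) * Real.log (1 / κ a b)]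
  rw [sum_pairEmpirical_mul x fun p => Real.log (1 / κ p.1 p.2), ← Finset.sum_neg_distrib,
    Real.exp_sum]
  refine Finset.prod_congr rfl fun i _ => ?_
  rw [one_div, Real.log_inv, neg_neg, Real.exp_log (h i)]

lemma isSupported_pairEmpirical {X : Type*} {n : ℕ} {x : Fin (n + 1) → X} {κ : Matrix X X ℝ}
    (h : ∀ i : Fin n, 0 < κ (x i.castSucc) (x i.succ)) : IsSupported κ (pairEmpirical x) := by
  classical
  intro a b hab
  unfold pairEmpirical
  rw [div_eq_zero_iff, Nat.cast_eq_zero, Finset.card_eq_zero, Finset.filter_eq_empty_iff]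
  refine Or.inl fun i _ hi => (h i).ne' ?_
  rw [Prod.mk.injEq] at hi
  rw [hi.1, hi.2, hab]

end Words

section Upper

variable {X : Type*} [Fintype X] {μ : X → ℝ} {π : Matrix X X ℝ}

lemma energy_sub_energy_condPmf (π : Matrix X X ℝ) {Q : X × X → ℝ} (hQ : 0 ≤ Q) :
    energy π Q - energy (Matrix.of (condPmf Q)) Q = pairRate π Q := by
  rw [pairRate_eq_energy_sub_condEntropy π hQ, condEntropy_eq hQ]
  simp [energy, Real.log_inv]

lemma condPmf_mem_rowStochastic [DecidableEq X] {Q : X × X → ℝ} (hQ : 0 ≤ Q) :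
    Matrix.of (condPmf Q) ∈ Matrix.rowStochastic ℝ X :=
  Matrix.mem_rowStochastic_iff_sum.2 ⟨condPmf_nonneg hQ, sum_condPmf Q⟩

/-- The method of types. A word with empirical pair measure `T` is more probable by the factor
`exp (n D(T))` under the Markov chain with the transition probabilities of `T`, so its probability
is at most `exp (-n D(T))` times a probability under one of polynomially many chains. -/
lemma prob_le_of_le_pairRate [DecidableEq X] (hμ : μ ∈ stdSimplex ℝ X) (hπ : ∀ a b, 0 ≤ π a b)
    (n : ℕ) (W : Set (Fin (n + 1) → X)) (c : ℝ)
    (hW : ∀ x ∈ W, 0 < markovPmf μ π (n + 1) x → c ≤ pairRate π (pairEmpirical x)) :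
    prob (markovPmf μ π (n + 1)) W
      ≤ ((n : ℝ) + 1) ^ Fintype.card (X × X) * Real.exp (-(n * c)) := by
  classical
  let types : Finset (X × X → ℝ) :=
    Finset.univ.image fun (k : X × X → Fin (n + 1)) p => ((k p : ℕ) : ℝ) / n
  have htypes : ∀ x : Fin (n + 1) → X, pairEmpirical x ∈ types := fun x => by
    refine Finset.mem_image.2 ⟨fun p => ⟨(Finset.univ.filter fun i : Fin n =>
      (x i.castSucc, x i.succ) = p).card, ?_⟩, Finset.mem_univ _, ?_⟩
    · exact Nat.lt_succ_of_le ((Finset.card_le_univ _).trans_eq (Fintype.card_fin n))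
    · funext p
      simp only [pairEmpirical]
      congr!
  have hcard : (types.card : ℝ) ≤ ((n : ℝ) + 1) ^ Fintype.card (X × X) := by
    have : types.card ≤ (n + 1) ^ Fintype.card (X × X) := by
      refine Finset.card_image_le.trans_eq ?_
      rw [Finset.card_univ, Fintype.card_fun, Fintype.card_fin]
    exact_mod_cast this
  have hnonneg : ∀ T ∈ types, 0 ≤ T := fun T hT p => by
    obtain ⟨k, -, rfl⟩ := Finset.mem_image.1 hT
    simp only [Pi.zero_apply]
    positivity
  have hword : ∀ x, W.indicator (markovPmf μ π (n + 1)) x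
      ≤ Real.exp (-(n * c)) * ∑ T ∈ types, markovPmf μ (Matrix.of (condPmf T)) (n + 1) x := by
    intro x
    have hpos : ∀ T ∈ types, 0 ≤ markovPmf μ (Matrix.of (condPmf T)) (n + 1) x := fun T hT =>
      markovPmf_nonneg hμ.1 (condPmf_nonneg (hnonneg T hT)) _ x
    by_cases hx : x ∈ W ∧ 0 < markovPmf μ π (n + 1) x
    · rw [Set.indicator_of_mem hx.1]
      have hrate := hW x hx.1 hx.2
      obtain ⟨-, hpi⟩ := pos_of_markovPmf_pos hμ.1 hπ hx.2
      have hT := pairEmpirical_nonneg x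
      calc markovPmf μ π (n + 1) x
          = Real.exp (-(n * pairRate π (pairEmpirical x)))
            * markovPmf μ (Matrix.of (condPmf (pairEmpirical x))) (n + 1) x := by
            rw [← energy_sub_energy_condPmf π hT, markovPmf, markovPmf, prod_eq_exp_energy x π hpi,
              prod_eq_exp_energy x (Matrix.of (condPmf (pairEmpirical x)))
                fun i => condPmf_pos hT (pairEmpirical_pos x i), mul_left_comm, ← Real.exp_add]
            congr 2
            ring
        _ ≤ Real.exp (-(n * c))
            * markovPmf μ (Matrix.of (condPmf (pairEmpirical x))) (n + 1) x := by
            gcongr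
            exact hpos _ (htypes x)
        _ ≤ _ := by
            gcongr
            exact Finset.single_le_sum
              (f := fun T => markovPmf μ (Matrix.of (condPmf T)) (n + 1) x) hpos (htypes x)
    · have h0 : W.indicator (markovPmf μ π (n + 1)) x ≤ 0 := by
        by_cases hxW : x ∈ W
        · rw [Set.indicator_of_mem hxW]
          exact not_lt.1 fun h => hx ⟨hxW, h⟩
        · rw [Set.indicator_of_notMem hxW]
      exact h0.trans (mul_nonneg (Real.exp_pos _).le (Finset.sum_nonneg hpos))
  calc prob (markovPmf μ π (n + 1)) W
      ≤ ∑ x, Real.exp (-(n * c)) * ∑ T ∈ types, markovPmf μ (Matrix.of (condPmf T)) (n + 1) x :=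
        Finset.sum_le_sum fun x _ => hword x
    _ = types.card * Real.exp (-(n * c)) := by
        rw [← Finset.mul_sum, Finset.sum_comm, Finset.sum_congr rfl fun T hT =>
          sum_markovPmf hμ (condPmf_mem_rowStochastic (hnonneg T hT)) (n + 1)]
        simp [mul_comm]
    _ ≤ _ := by gcongr

lemma eventually_pow_le_exp (d : ℕ) {δ : ℝ} (hδ : 0 < δ) :
    ∀ᶠ n : ℕ in atTop, ((n : ℝ) + 1) ^ d ≤ Real.exp (n * δ) := by
  have h := (isLittleO_pow_exp_pos_mul_atTop (k := d) hδ).def (Real.exp_pos (-δ))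
  have ht : Tendsto (fun n : ℕ => (n : ℝ) + 1) atTop atTop :=
    tendsto_atTop_add_const_right _ _ tendsto_natCast_atTop_atTop
  filter_upwards [ht.eventually h] with n hn
  have h1 : (0 : ℝ) ≤ ((n : ℝ) + 1) ^ d := by positivity
  rw [Real.norm_of_nonneg h1, Real.norm_of_nonneg (Real.exp_pos _).le, ← Real.exp_add] at hn
  refine hn.trans_eq ?_
  congr 1
  ring

/-- The upper bound of the large deviation principle, for events that need not be given by the
empirical pair measure alone: only the rate at the limit points of the empirical pair measures of
the words in the events matters. -/
theorem eventually_prob_le_exp [DecidableEq X] (hμ : μ ∈ stdSimplex ℝ X)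
    (hπ : ∀ a b, 0 ≤ π a b) (W : ∀ n, Set (Fin (n + 1) → X)) (c : ℝ)
    (h : ∀ Q ∈ stationaryPairs X, IsSupported π Q →
      (∀ ε > 0, ∃ᶠ n in atTop, ∃ x ∈ W n, 0 < markovPmf μ π (n + 1) x ∧
        dist (pairEmpirical x) Q < ε) → c < pairRate π Q) :
    ∀ᶠ n : ℕ in atTop, prob (markovPmf μ π (n + 1)) (W n) ≤ Real.exp (-(n * c)) := by
  have key : ∃ δ > 0, ∀ᶠ n in atTop, ∀ x ∈ W n, 0 < markovPmf μ π (n + 1) x →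
      c + δ ≤ pairRate π (pairEmpirical x) := by
    by_contra! hcon
    have hseq : ∀ k : ℕ, ∃ n, k + 1 ≤ n ∧ ∃ x ∈ W n, 0 < markovPmf μ π (n + 1) x ∧
        pairRate π (pairEmpirical x) < c + 1 / ((k : ℝ) + 1) := fun k => by
      obtain ⟨n, hn, x, hx⟩ :=
        frequently_atTop.1 (hcon (1 / ((k : ℝ) + 1)) (by positivity)) (k + 1)
      exact ⟨n, hn, x, hx⟩
    choose n hn x hxW hxpos hxrate using hseq
    obtain ⟨Q, hQ, φ, hφ, hlim⟩ := (isCompact_stdSimplex (𝕜 := ℝ) (X × X)).tendsto_subseq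
      fun k => pairEmpirical_mem_stdSimplex (by have := hn k; omega) (x k)
    have hnφ : Tendsto (fun k => n (φ k)) atTop atTop :=
      tendsto_atTop_mono (fun k => (hφ.id_le k).trans (by have := hn (φ k); simp; omega)) tendsto_id
    have hstat : Q ∈ stationaryPairs X := by
      refine ⟨hQ, fun a => sub_eq_zero.1 (abs_eq_zero.1 (le_antisymm ?_ (abs_nonneg _)))⟩
      have hcont : Continuous fun T : X × X → ℝ => |∑ b, T (b, a) - ∑ b, T (a, b)| := by fun_prop
      refine le_of_tendsto_of_tendsto ((hcont.tendsto Q).comp hlim)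
        (tendsto_one_div_atTop_nhds_zero_nat.comp hnφ) (Eventually.of_forall fun k => ?_)
      have hpos : (0 : ℝ) < n (φ k) := by have := hn (φ k); exact_mod_cast (by omega)
      simp only [Function.comp_apply]
      rw [le_div_iff₀' hpos]
      exact abs_marginal_sub_le (x (φ k)) a
    have hsupp : IsSupported π Q :=
      (isClosed_isSupported π).mem_of_tendsto hlim (Eventually.of_forall fun k =>
        isSupported_pairEmpirical (pos_of_markovPmf_pos hμ.1 hπ (hxpos (φ k))).2)
    have hle : pairRate π Q ≤ c + 0 := by
      refine le_of_tendsto_of_tendsto (((continuous_pairRate π).tendsto Q).comp hlim)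
        (tendsto_const_nhds.add (tendsto_one_div_add_atTop_nhds_zero_nat.comp hφ.tendsto_atTop))
        (Eventually.of_forall fun k => (hxrate (φ k)).le)
    have := h Q hstat hsupp fun ε hε => by
      rw [frequently_atTop]
      intro N
      obtain ⟨k, hk1, hk2⟩ :=
        ((hnφ.eventually_ge_atTop N).and (hlim.eventually (Metric.ball_mem_nhds Q hε))).exists
      exact ⟨n (φ k), hk1, x (φ k), hxW _, hxpos _, hk2⟩
    linarith
  obtain ⟨δ, hδ, hev⟩ := key
  filter_upwards [hev, eventually_pow_le_exp (Fintype.card (X × X)) hδ] with n h1 h2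
  refine (prob_le_of_le_pairRate hμ hπ n (W n) (c + δ) h1).trans ?_
  calc _ ≤ Real.exp (n * δ) * Real.exp (-(n * (c + δ))) := by gcongr
    _ = _ := by rw [← Real.exp_add]; congr 1; ring

end Upper

/-! ### The law of large numbers and the change of measure -/

section Lower

variable {X : Type*} [Fintype X] [DecidableEq X] {μ : X → ℝ} {π : Matrix X X ℝ}

/-- Irreducibility depends on the positive entries only. -/
lemma isIrreducible_of_pos {A B : Matrix X X ℝ} (hA : A.IsIrreducible) (hB : ∀ a b, 0 ≤ B a b)
    (h : ∀ a b, 0 < A a b → 0 < B a b) : B.IsIrreducible := by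
  rw [Matrix.isIrreducible_iff_exists_pow_pos hB]
  have hpow : ∀ (k : ℕ), (∀ a b, 0 ≤ (A ^ k) a b ∧ 0 ≤ (B ^ k) a b ∧
      (0 < (A ^ k) a b → 0 < (B ^ k) a b)) := fun k => by
    induction k with
    | zero => intro a b; simp only [pow_zero, Matrix.one_apply]; split_ifs <;> norm_num
    | succ k ih =>
      intro a b
      simp only [pow_succ, Matrix.mul_apply]
      have h1 : ∀ l ∈ Finset.univ, 0 ≤ (A ^ k) a l * A l b := fun l _ =>
        mul_nonneg (ih a l).1 (hA.nonneg l b)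
      have h2 : ∀ l ∈ Finset.univ, 0 ≤ (B ^ k) a l * B l b := fun l _ =>
        mul_nonneg (ih a l).2.1 (hB l b)
      refine ⟨Finset.sum_nonneg h1, Finset.sum_nonneg h2, fun hpos => ?_⟩
      obtain ⟨l, hl, hl0⟩ := Finset.exists_ne_zero_of_sum_ne_zero hpos.ne'
      rw [mul_ne_zero_iff] at hl0
      exact Finset.sum_pos' h2 ⟨l, hl, mul_pos
        ((ih a l).2.2 (lt_of_le_of_ne (ih a l).1 hl0.1.symm))
        (h l b (lt_of_le_of_ne (hA.nonneg l b) hl0.2.symm))⟩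
  intro a b
  obtain ⟨k, hk, hpos⟩ := (Matrix.isIrreducible_iff_exists_pow_pos hA.nonneg).1 hA a b
  exact ⟨k, hk, (hpow k a b).2.2 hpos⟩

lemma transpose_mulVec_marginal {X : Type*} [Fintype X] {π : Matrix X X ℝ}
    {Q : X × X → ℝ} (hQ : Q ∈ stationaryPairs X)
    (h : ∀ a b, Q (a, b) = marginal Q a * π a b) :
    π.transpose.mulVec (marginal Q) = (1 : ℝ) • marginal Q := by
  rw [one_smul]
  funext b
  calc _ = ∑ a, Q (a, b) := Finset.sum_congr rfl fun a _ => by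
        rw [h]; exact mul_comm _ _
    _ = _ := hQ.2 b

lemma sum_marginal {X : Type*} [Fintype X] {Q : X × X → ℝ} (hQ : Q ∈ stdSimplex ℝ (X × X)) :
    ∑ a, marginal Q a = 1 := by
  rw [← hQ.2, Fintype.sum_prod_type]; rfl

/-- An irreducible chain has at most one stationary pair measure. -/
lemma stationaryPair_unique [Nonempty X] (hirr : π.IsIrreducible) {Q Q' : X × X → ℝ}
    (hQ : Q ∈ stationaryPairs X) (hQ' : Q' ∈ stationaryPairs X)
    (h : ∀ a b, Q (a, b) = marginal Q a * π a b)
    (h' : ∀ a b, Q' (a, b) = marginal Q' a * π a b) : Q = Q' := by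
  have hs := sum_marginal hQ.1
  have hs' := sum_marginal hQ'.1
  have hpos := pos_of_eigenvector hirr.transpose (fun a => marginal_nonneg hQ'.1.1 a)
    (fun h0 => by simp [h0] at hs') (transpose_mulVec_marginal hQ' h')
  obtain ⟨t, ht⟩ := eigenvector_eq_smul hirr.transpose hpos (transpose_mulVec_marginal hQ' h')
    (transpose_mulVec_marginal hQ h)
  have ht1 : t = 1 := by
    rw [ht] at hs
    simpa [← Finset.mul_sum, hs'] using hs
  funext ⟨a, b⟩
  rw [h, h', ht, ht1, one_smul]

/-- The law of large numbers for an irreducible chain. It follows from the large deviation upper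
bound, since the rate vanishes at the stationary pair measure only. -/
lemma eventually_half_le_prob_dist_lt [Nonempty X] (hμ : μ ∈ stdSimplex ℝ X)
    (hπ : π ∈ Matrix.rowStochastic ℝ X) (hirr : π.IsIrreducible) {Q' : X × X → ℝ}
    (hQ' : Q' ∈ stationaryPairs X) (h' : ∀ a b, Q' (a, b) = marginal Q' a * π a b)
    {δ : ℝ} (hδ : 0 < δ) :
    ∀ᶠ n : ℕ in atTop,
      1 / 2 ≤ prob (markovPmf μ π (n + 1)) {x | dist (pairEmpirical x) Q' < δ} := by
  have hc : ∃ c > 0, ∀ Q ∈ stationaryPairs X ∩ {Q | IsSupported π Q} ∩ {Q | δ ≤ dist Q Q'},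
      c < pairRate π Q := by
    have hcomp : IsCompact
        (stationaryPairs X ∩ {Q | IsSupported π Q} ∩ {Q | δ ≤ dist Q Q'}) :=
      (isCompact_stationaryPairs_inter_isSupported π).inter_right
        (isClosed_le continuous_const (by fun_prop))
    rcases Set.eq_empty_or_nonempty
      (stationaryPairs X ∩ {Q | IsSupported π Q} ∩ {Q | δ ≤ dist Q Q'}) with he | hne
    · exact ⟨1, one_pos, fun Q hQ => by rw [he] at hQ; exact hQ.elim⟩
    · obtain ⟨Q, ⟨⟨hQ, hs⟩, hd⟩, hmin⟩ :=
        hcomp.exists_isMinOn hne (continuous_pairRate π).continuousOn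
      have hpos : 0 < pairRate π Q := by
        refine lt_of_le_of_ne (pairRate_nonneg hπ hQ.1.1 hs) fun h0 => ?_
        have := stationaryPair_unique hirr hQ hQ'
          (eq_mul_of_pairRate_eq_zero hπ hQ.1.1 hs h0.symm) h'
        rw [this, Set.mem_ofPred_eq, dist_self] at hd
        linarith
      exact ⟨pairRate π Q / 2, by linarith, fun R hR => by
        have := hmin hR
        simp only [Set.mem_ofPred_eq] at this
        linarith⟩
  obtain ⟨c, hc0, hc⟩ := hc
  have hup := eventually_prob_le_exp hμ hπ.1
    (fun n => {x : Fin (n + 1) → X | dist (pairEmpirical x) Q' < δ}ᶜ) c fun Q hQ hs hcl => by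
      refine hc Q ⟨⟨hQ, hs⟩, ?_⟩
      refine le_of_forall_pos_le_add (a := δ) (b := dist Q Q') fun ε hε => ?_
      obtain ⟨n, x, hx, -, hd⟩ := (hcl ε hε).exists
      have hx : δ ≤ dist (pairEmpirical x) Q' := not_lt.1 hx
      have := dist_triangle (pairEmpirical x) Q Q'
      linarith
  have hexp : ∀ᶠ n : ℕ in atTop, Real.exp (-(n * c)) < 1 / 2 := by
    have : Tendsto (fun n : ℕ => Real.exp (-(n * c))) atTop (𝓝 0) :=
      Real.tendsto_exp_neg_atTop_nhds_zero.comp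
        (tendsto_natCast_atTop_atTop.atTop_mul_const hc0)
    exact this.eventually_lt_const (by norm_num)
  filter_upwards [hup, hexp] with n h1 h2
  have := prob_add_prob_compl (markovPmf μ π (n + 1)) {x | dist (pairEmpirical x) Q' < δ}
  rw [sum_markovPmf hμ hπ] at this
  linarith

/-- The lower bound of the large deviation principle: `Q` is approximated by a measure that charges
all possible transitions, whose conditional pmf is the transition matrix of an irreducible chain;
by the law of large numbers this chain follows the approximating measure, and the density of the
two chains on such words is `exp (-n D)` up to a small error in the exponent. -/
theorem eventually_exp_le_prob_dist_lt [Nonempty X] (hμ : μ ∈ stdSimplex ℝ X)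
    (hπ : π ∈ Matrix.rowStochastic ℝ X) (hirr : π.IsIrreducible) {Q : X × X → ℝ}
    (hQ : Q ∈ stationaryPairs X) (hs : IsSupported π Q) {c : ℝ} (hc : pairRate π Q < c)
    {ε : ℝ} (hε : 0 < ε) :
    ∀ᶠ n : ℕ in atTop, Real.exp (-(n * c))
      ≤ prob (markovPmf μ π (n + 1)) {x | dist (pairEmpirical x) Q < ε} := by
  obtain ⟨r, v, w, hr, hv, hw, hAv, hwA⟩ := exists_pos_eigenvectors hirr
  set Q₀ := tiltedPair π r v w with hQ₀def
  have hQ₀ : Q₀ ∈ stationaryPairs X :=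
    tiltedPair_mem_stationaryPairs hirr.nonneg hr hv hw hAv hwA
  -- a small perturbation towards a measure with full support
  obtain ⟨t, ht0, ht1, htd, htr⟩ : ∃ t : ℝ, 0 < t ∧ t < 1 ∧
      dist ((1 - t) • Q + t • Q₀) Q < ε / 2 ∧ pairRate π ((1 - t) • Q + t • Q₀) < c := by
    have hcont : Continuous fun t : ℝ => (1 - t) • Q + t • Q₀ := by fun_prop
    have h0 : (1 - (0 : ℝ)) • Q + (0 : ℝ) • Q₀ = Q := by simp
    have h1 : ∀ᶠ t : ℝ in 𝓝 0, dist ((1 - t) • Q + t • Q₀) Q < ε / 2 :=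
      (hcont.tendsto 0).eventually (by rw [h0]; exact Metric.ball_mem_nhds Q (half_pos hε))
    have h2 : ∀ᶠ t : ℝ in 𝓝 0, pairRate π ((1 - t) • Q + t • Q₀) < c :=
      (((continuous_pairRate π).comp hcont).tendsto 0).eventually_lt_const
        (by simpa only [Function.comp_apply, h0] using hc)
    obtain ⟨t, ⟨h1, h2, h3⟩, h4⟩ := ((h1.and (h2.and (gt_mem_nhds one_pos))).filter_mono
      nhdsWithin_le_nhds |>.and (self_mem_nhdsWithin (s := Set.Ioi (0 : ℝ)))).exists
    exact ⟨t, h4, h3, h1, h2⟩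
  set Q' := (1 - t) • Q + t • Q₀ with hQ'def
  have hQ'0 : 0 ≤ Q' := fun p => add_nonneg (mul_nonneg (by linarith) (hQ.1.1 p))
    (mul_nonneg ht0.le (hQ₀.1.1 p))
  have hQ' : Q' ∈ stationaryPairs X := by
    refine ⟨⟨hQ'0, ?_⟩, fun a => ?_⟩
    · simp [hQ'def, Finset.sum_add_distrib, ← Finset.mul_sum, hQ.1.2, hQ₀.1.2]
    · simp [hQ'def, Finset.sum_add_distrib, ← Finset.mul_sum, hQ.2, hQ₀.2]
  have hpos : ∀ a b, 0 < π a b → 0 < Q' (a, b) := fun a b hab =>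
    add_pos_of_nonneg_of_pos (mul_nonneg (by linarith) (hQ.1.1 _))
      (mul_pos ht0 (tiltedPair_pos hr hv hw hab))
  have hs' : IsSupported π Q' := fun a b hab => by
    simp [hQ'def, hs a b hab, hQ₀def, tiltedPair, hab]
  set η : Matrix X X ℝ := Matrix.of (condPmf Q') with hη
  have hηs : η ∈ Matrix.rowStochastic ℝ X := condPmf_mem_rowStochastic hQ'0
  have hηirr : η.IsIrreducible :=
    isIrreducible_of_pos hirr hηs.1 fun a b hab => condPmf_pos hQ'0 (hpos a b hab)
  have hmpos : ∀ a, marginal Q' a ≠ 0 := fun a h0 => by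
    have h1 : ∀ b, π a b = 0 := fun b => by
      by_contra hne
      exact (hpos a b (lt_of_le_of_ne (hπ.1 a b) (Ne.symm hne))).ne'
        (eq_zero_of_marginal_eq_zero hQ'0 h0 b)
    have h2 := Matrix.sum_row_of_mem_rowStochastic hπ a
    simp [h1] at h2
  -- the exponent of the density of the two chains is nearly constant near `Q'`
  have hG : Continuous fun T : X × X → ℝ => energy π T - energy η T :=
    (continuous_energy π).sub (continuous_energy η)
  obtain ⟨c', hc'1, hc'2⟩ := exists_between htr
  obtain ⟨δ, hδ, hball⟩ : ∃ δ > 0, ∀ T : X × X → ℝ, dist T Q' < δ →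
      energy π T - energy η T < c' := by
    have : ∀ᶠ T in 𝓝 Q', energy π T - energy η T < c' :=
      (hG.tendsto Q').eventually_lt_const (by rwa [hη, energy_sub_energy_condPmf π hQ'0])
    obtain ⟨δ, hδ, h⟩ := Metric.eventually_nhds_iff.1 this
    exact ⟨δ, hδ, fun T hT => h hT⟩
  have hlln := eventually_half_le_prob_dist_lt hμ hηs hηirr hQ'
    (fun a b => (marginal_mul_condPmf hQ'0 a b).symm) (lt_min hδ (half_pos hε))
  have hexp : ∀ᶠ n : ℕ in atTop, 2 ≤ Real.exp (n * (c - c')) := by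
    have : Tendsto (fun n : ℕ => Real.exp (n * (c - c'))) atTop atTop :=
      Real.tendsto_exp_atTop.comp
        (tendsto_natCast_atTop_atTop.atTop_mul_const (sub_pos.2 hc'2))
    exact this.eventually_ge_atTop 2
  filter_upwards [hlln, hexp] with n h1 h2
  have hword : ∀ x, Real.exp (-(n * c')) *
      {x | dist (pairEmpirical x) Q' < min δ (ε / 2)}.indicator (markovPmf μ η (n + 1)) x
      ≤ {x | dist (pairEmpirical x) Q < ε}.indicator (markovPmf μ π (n + 1)) x := by
    intro x
    have hnn : 0 ≤ {x | dist (pairEmpirical x) Q < ε}.indicator (markovPmf μ π (n + 1)) x :=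
      Set.indicator_nonneg (fun x _ => markovPmf_nonneg hμ.1 hπ.1 _ x) x
    by_cases hx : dist (pairEmpirical x) Q' < min δ (ε / 2) ∧ 0 < markovPmf μ η (n + 1) x
    · have hd : dist (pairEmpirical x) Q < ε := by
        have := dist_triangle (pairEmpirical x) Q' Q
        have := hx.1.trans_le (min_le_right _ _)
        linarith
      rw [Set.indicator_of_mem (by exact hx.1), Set.indicator_of_mem (by exact hd)]
      obtain ⟨hx0, hηx⟩ := pos_of_markovPmf_pos hμ.1 hηs.1 hx.2
      have hπx : ∀ i : Fin n, 0 < π (x i.castSucc) (x i.succ) := fun i =>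
        lt_of_le_of_ne (hπ.1 _ _) fun h0 => (hηx i).ne'
          (condPmf_eq_zero_of_isSupported hs' (hmpos _) _ h0.symm)
      have hg := hball _ (hx.1.trans_le (min_le_left _ _))
      rw [markovPmf, markovPmf, prod_eq_exp_energy x π hπx, prod_eq_exp_energy x η hηx,
        mul_left_comm, ← Real.exp_add]
      refine mul_le_mul_of_nonneg_left (Real.exp_le_exp.2 ?_) hx0.le
      have := mul_le_mul_of_nonneg_left hg.le (Nat.cast_nonneg (α := ℝ) n)
      linarith
    · refine le_trans (mul_nonpos_of_nonneg_of_nonpos (Real.exp_pos _).le ?_) hnn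
      by_cases hxd : dist (pairEmpirical x) Q' < min δ (ε / 2)
      · rw [Set.indicator_of_mem (by exact hxd)]
        exact not_lt.1 fun h => hx ⟨hxd, h⟩
      · rw [Set.indicator_of_notMem (by exact hxd)]
  calc Real.exp (-(n * c)) = Real.exp (-(n * c')) * (Real.exp (n * (c - c')))⁻¹ := by
        rw [← Real.exp_neg, ← Real.exp_add]; congr 1; ring
    _ ≤ Real.exp (-(n * c')) * (1 / 2) := by
        rw [one_div]; gcongr
    _ ≤ Real.exp (-(n * c')) * prob (markovPmf μ η (n + 1))
          {x | dist (pairEmpirical x) Q' < min δ (ε / 2)} := by gcongr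
    _ ≤ _ := by
        rw [prob, Finset.mul_sum]
        exact Finset.sum_le_sum fun x _ => hword x

end Lower

/-! ### Large deviation principles in terms of real exponents -/

lemma law_apply {A S : Type*} [Fintype A] [MeasurableSpace S] [MeasurableSingletonClass S]
    {p : A → ℝ} (hp : 0 ≤ p) (f : A → S) (K : Set S) :
    law p f K = ENNReal.ofReal (prob p (f ⁻¹' K)) := by
  classical
  rw [law, prob, Measure.coe_finsetSum, Finset.sum_apply, ENNReal.ofReal_sum_of_nonneg
    fun a _ => Set.indicator_nonneg (fun a _ => hp a) a]
  refine Finset.sum_congr rfl fun a _ => ?_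
  rw [Measure.smul_apply, Measure.dirac_apply, smul_eq_mul]
  by_cases h : f a ∈ K
  · rw [Set.indicator_of_mem h, Set.indicator_of_mem (by exact h), Pi.one_apply, mul_one]
  · rw [Set.indicator_of_notMem h, Set.indicator_of_notMem (by exact h), mul_zero,
      ENNReal.ofReal_zero]

lemma lowerSemicontinuous_of_isClosed_level {S : Type*} [TopologicalSpace S] {I : S → ℝ≥0∞}
    (h : ∀ c : ℝ≥0, IsClosed {s | I s ≤ c}) : LowerSemicontinuous I := by
  rw [lowerSemicontinuous_iff_isClosed_preimage]
  intro y
  induction y with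
  | top => simp
  | coe c => exact h c

/-- The large deviation property for measures with real masses, with the bounds stated as
exponential inequalities that hold for all large `n`. -/
theorem SatisfiesLDP.of_real {S : Type*} [TopologicalSpace S] [T2Space S] [MeasurableSpace S]
    {ν : ℕ → Measure S} {I : S → ℝ≥0∞} (p : ℕ → Set S → ℝ)
    (hν : ∀ n K, ν n K = ENNReal.ofReal (p n K))
    (hcomp : ∀ c : ℝ≥0, IsCompact {s | I s ≤ c})
    (hupper : ∀ K : Set S, IsClosed K → ∀ c : ℝ, (∀ s ∈ K, (c : EReal) < I s) → ∀ c' < c,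
      ∀ᶠ n : ℕ in atTop, p n K ≤ Real.exp (-(n * c')))
    (hlower : ∀ U : Set S, IsOpen U → ∀ s ∈ U, ∀ c : ℝ, (I s : EReal) < c →
      ∀ᶠ n : ℕ in atTop, Real.exp (-(n * c)) ≤ p n U) :
    SatisfiesLDP ν I := by
  have hlog : ∀ (n : ℕ) (z : ℝ), ENNReal.log (ENNReal.ofReal (Real.exp (-(n * z))))
      = (n : EReal) * ((-z : ℝ) : EReal) := fun n z => by
    rw [ENNReal.log_ofReal_of_pos (Real.exp_pos _), Real.log_exp, ← mul_neg, EReal.coe_mul]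
    rfl
  have hn0 : ∀ n : ℕ, 0 < n → (0 : EReal) < n := fun n hn => by exact_mod_cast hn
  have hntop : ∀ n : ℕ, (n : EReal) ≠ ⊤ := fun n => EReal.natCast_ne_top n
  refine ⟨lowerSemicontinuous_of_isClosed_level fun c => (hcomp c).isClosed, hcomp,
    fun K hK => ?_, fun U hU => ?_⟩
  · rw [EReal.le_neg, ← EReal.ge_of_forall_gt_iff_ge]
    intro z hz
    obtain ⟨c, hzc, hc⟩ := EReal.lt_iff_exists_real_btwn.1 hz
    rw [EReal.le_neg, ← EReal.coe_neg]
    have hev := hupper K hK c (fun s hs => hc.trans_le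
      (EReal.coe_ennreal_le_coe_ennreal_iff.2 (iInf₂_le s hs))) z (EReal.coe_lt_coe_iff.1 hzc)
    refine limsup_le_of_le (by isBoundedDefault) ?_
    filter_upwards [hev, eventually_gt_atTop 0] with n h1 hn
    rw [EReal.div_le_iff_le_mul (hn0 n hn) (hntop n), hν, ← hlog]
    exact ENNReal.log_le_log (ENNReal.ofReal_le_ofReal h1)
  · rw [← EReal.ge_of_forall_gt_iff_ge]
    intro z hz
    rw [EReal.lt_neg_comm, ← EReal.coe_neg] at hz
    obtain ⟨s, hs, hlt⟩ : ∃ s ∈ U, (I s : EReal) < ((-z : ℝ) : EReal) := by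
      by_contra! hcon
      have h1 : ENNReal.ofReal (-z) ≤ ⨅ s ∈ U, I s := le_iInf₂ fun s hs => by
        rw [← EReal.coe_ennreal_le_coe_ennreal_iff, EReal.coe_ennreal_ofReal]
        rw [EReal.coe_strictMono.monotone.map_max]
        exact max_le (hcon s hs) (EReal.coe_ennreal_nonneg _)
      rw [← EReal.coe_ennreal_le_coe_ennreal_iff, EReal.coe_ennreal_ofReal,
        EReal.coe_strictMono.monotone.map_max] at h1
      exact absurd ((le_max_left _ _).trans h1) (not_le.2 hz)
    refine le_liminf_of_le (by isBoundedDefault) ?_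
    filter_upwards [hlower U hU s hs (-z) hlt, eventually_gt_atTop 0] with n h1 hn
    rw [EReal.le_div_iff_mul_le (hn0 n hn) (hntop n), hν, mul_comm]
    have h2 := hlog n (-z)
    rw [neg_neg] at h2
    rw [← h2]
    exact ENNReal.log_le_log (ENNReal.ofReal_le_ofReal h1)

section LDP

variable {X : Type*} [Fintype X] [DecidableEq X] {μ : X → ℝ} {π : Matrix X X ℝ}

lemma coe_levelTwoRate (hπ : π ∈ Matrix.rowStochastic ℝ X) {Q : X × X → ℝ}
    (hQ : Q ∈ stationaryPairs X) (hs : IsSupported π Q) :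
    ((levelTwoRate π Q : ℝ≥0∞) : EReal) = ((pairRate π Q : ℝ) : EReal) := by
  rw [levelTwoRate_eq_ofReal hπ hQ hs, EReal.coe_ennreal_ofReal,
    max_eq_left (pairRate_nonneg hπ hQ.1.1 hs)]

lemma mem_of_levelTwoRate_ne_top {X : Type*} [Fintype X] {π : Matrix X X ℝ} {Q : X × X → ℝ}
    (h : levelTwoRate π Q ≠ ⊤) : Q ∈ stationaryPairs X ∧ IsSupported π Q := by
  by_contra hcon
  exact h (levelTwoRate_eq_top hcon)

lemma isCompact_level_levelTwoRate (hπ : π ∈ Matrix.rowStochastic ℝ X) (c : ℝ≥0) :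
    IsCompact {Q | levelTwoRate π Q ≤ c} := by
  have : {Q | levelTwoRate π Q ≤ c}
      = (stationaryPairs X ∩ {Q | IsSupported π Q}) ∩ {Q | pairRate π Q ≤ c} := by
    ext Q
    constructor
    · intro hQ
      have h := mem_of_levelTwoRate_ne_top (ne_top_of_le_ne_top ENNReal.coe_ne_top hQ)
      refine ⟨h, ?_⟩
      have hQ : levelTwoRate π Q ≤ c := hQ
      rw [levelTwoRate_eq_ofReal hπ h.1 h.2] at hQ
      exact (ENNReal.ofReal_le_iff_le_toReal ENNReal.coe_ne_top).1 hQ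
    · rintro ⟨⟨h1, h2⟩, h3⟩
      change levelTwoRate π Q ≤ c
      rw [levelTwoRate_eq_ofReal hπ h1 h2]
      exact (ENNReal.ofReal_le_iff_le_toReal ENNReal.coe_ne_top).2 h3
  rw [this]
  exact (isCompact_stationaryPairs_inter_isSupported π).inter_right
    (isClosed_le (continuous_pairRate π) continuous_const)

/-- The large deviation principle of the empirical pair measure. -/
theorem satisfiesLDP_pairEmpirical [Nonempty X] (hμ : μ ∈ stdSimplex ℝ X)
    (hπ : π ∈ Matrix.rowStochastic ℝ X) (hirr : π.IsIrreducible) :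
    SatisfiesLDP (fun n => law (markovPmf μ π (n + 1)) pairEmpirical) (levelTwoRate π) := by
  refine SatisfiesLDP.of_real
    (fun n K => prob (markovPmf μ π (n + 1)) (pairEmpirical ⁻¹' K))
    (fun n K => law_apply (markovPmf_nonneg hμ.1 hπ.1 _) _ K)
    (isCompact_level_levelTwoRate hπ) (fun K hK c hc c' hc' => ?_) fun U hU Q hQU c hc => ?_
  · have := eventually_prob_le_exp hμ hπ.1 (fun n => pairEmpirical ⁻¹' K) c
      fun Q hQ hs hcl => by
        have hQK : Q ∈ K := by
          rw [← hK.closure_eq, Metric.mem_closure_iff]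
          intro ε hε
          obtain ⟨n, x, hx, -, hd⟩ := (hcl ε hε).exists
          exact ⟨pairEmpirical x, hx, by rwa [dist_comm]⟩
        have := hc Q hQK
        rwa [coe_levelTwoRate hπ hQ hs, EReal.coe_lt_coe_iff] at this
    filter_upwards [this] with n hn
    refine hn.trans (Real.exp_le_exp.2 (neg_le_neg ?_))
    gcongr
  · have hfin : levelTwoRate π Q ≠ ⊤ := fun h => by simp [h] at hc
    obtain ⟨hQ, hs⟩ := mem_of_levelTwoRate_ne_top hfin
    rw [coe_levelTwoRate hπ hQ hs, EReal.coe_lt_coe_iff] at hc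
    obtain ⟨ε, hε, hball⟩ := Metric.isOpen_iff.1 hU Q hQU
    filter_upwards [eventually_exp_le_prob_dist_lt hμ hπ hirr hQ hs hc hε] with n hn
    exact hn.trans (prob_mono (markovPmf_nonneg hμ.1 hπ.1 _) fun x hx _ => hball hx)

/-! ### The information spectrum -/

lemma mem_theta_energy {X : Type*} [Fintype X] {π : Matrix X X ℝ} {Q : X × X → ℝ}
    (hQ : Q ∈ stationaryPairs X) (hs : IsSupported π Q) : Q ∈ theta π (energy π Q) :=
  ⟨hQ, hs, rfl⟩

lemma spectrumRate_energy_le {X : Type*} [Fintype X] {π : Matrix X X ℝ} {Q : X × X → ℝ}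
    (hQ : Q ∈ stationaryPairs X) (hs : IsSupported π Q) :
    spectrumRate π (energy π Q) ≤ levelTwoRate π Q :=
  iInf₂_le Q (mem_theta_energy hQ hs)

/-- The infimum in the contracted rate function is attained where it is finite. -/
lemma exists_levelTwoRate_le_spectrumRate (hπ : π ∈ Matrix.rowStochastic ℝ X) {t : ℝ}
    (ht : spectrumRate π t ≠ ⊤) :
    ∃ Q ∈ stationaryPairs X, IsSupported π Q ∧ energy π Q = t ∧
      levelTwoRate π Q ≤ spectrumRate π t := by
  have hcomp : IsCompact ((stationaryPairs X ∩ {Q | IsSupported π Q}) ∩ {Q | energy π Q = t}) :=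
    (isCompact_stationaryPairs_inter_isSupported π).inter_right
      (isClosed_eq (continuous_energy π) continuous_const)
  have hne : ((stationaryPairs X ∩ {Q | IsSupported π Q}) ∩ {Q | energy π Q = t}).Nonempty := by
    by_contra hempty
    refine ht (iInf₂_eq_top.2 fun Q hQ => (hempty ⟨Q, ⟨hQ.1, hQ.2.1⟩, hQ.2.2⟩).elim)
  obtain ⟨Q, ⟨⟨hQ, hs⟩, hQt⟩, hmin⟩ :=
    hcomp.exists_isMinOn hne (continuous_pairRate π).continuousOn
  refine ⟨Q, hQ, hs, hQt, le_iInf₂ fun R hR => ?_⟩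
  rw [levelTwoRate_eq_ofReal hπ hQ hs, levelTwoRate_eq_ofReal hπ hR.1 hR.2.1]
  exact ENNReal.ofReal_le_ofReal (hmin ⟨⟨hR.1, hR.2.1⟩, hR.2.2⟩)

lemma isCompact_level_spectrumRate (hπ : π ∈ Matrix.rowStochastic ℝ X) (c : ℝ≥0) :
    IsCompact {t | spectrumRate π t ≤ c} := by
  have : {t | spectrumRate π t ≤ c} = energy π '' {Q | levelTwoRate π Q ≤ c} := by
    ext t
    constructor
    · intro ht
      obtain ⟨Q, -, -, hQt, hle⟩ := exists_levelTwoRate_le_spectrumRate hπ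
        (ne_top_of_le_ne_top ENNReal.coe_ne_top ht)
      exact ⟨Q, hle.trans ht, hQt⟩
    · rintro ⟨Q, hQ, rfl⟩
      have h := mem_of_levelTwoRate_ne_top (ne_top_of_le_ne_top ENNReal.coe_ne_top hQ)
      exact (spectrumRate_energy_le h.1 h.2).trans hQ
  rw [this]
  exact (isCompact_level_levelTwoRate hπ c).image (continuous_energy π)

/-- On words of positive probability the information spectrum is, up to `O(1 / n)`, a continuous
function of the empirical pair measure. -/
lemma exists_abs_infoSpectrum_sub_energy_le {X : Type*} [Fintype X] {μ : X → ℝ}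
    {π : Matrix X X ℝ} (hμ : 0 ≤ μ) (hπ : ∀ a b, 0 ≤ π a b) :
    ∃ C : ℝ, ∀ n : ℕ, n ≠ 0 → ∀ x : Fin (n + 1) → X, 0 < markovPmf μ π (n + 1) x →
      |infoSpectrum (markovPmf μ π (n + 1)) x - energy π (pairEmpirical x)|
        ≤ C / ((n : ℝ) + 1) := by
  obtain ⟨B, hB⟩ := (isCompact_stdSimplex (𝕜 := ℝ) (X × X)).exists_bound_of_continuousOn
    (continuous_energy π).continuousOn
  refine ⟨∑ a, |Real.log (μ a)| + B, fun n hn x hx => ?_⟩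
  obtain ⟨hx0, hxπ⟩ := pos_of_markovPmf_pos hμ hπ hx
  have h1 : infoSpectrum (markovPmf μ π (n + 1)) x - energy π (pairEmpirical x)
      = -(Real.log (μ (x 0)) + energy π (pairEmpirical x)) / ((n : ℝ) + 1) := by
    rw [infoSpectrum, markovPmf, prod_eq_exp_energy x π hxπ,
      Real.log_mul hx0.ne' (Real.exp_pos _).ne', Real.log_exp, Nat.cast_succ]
    field_simp
    ring
  rw [h1, abs_div, abs_neg, abs_of_pos (by positivity : (0 : ℝ) < n + 1)]
  gcongr
  refine (abs_add_le _ _).trans (add_le_add ?_ ?_)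
  · exact Finset.single_le_sum (f := fun a => |Real.log (μ a)|) (fun _ _ => abs_nonneg _)
      (Finset.mem_univ _)
  · exact hB _ (pairEmpirical_mem_stdSimplex hn x)

lemma eventually_mul_succ_le {a b : ℝ} (h : a < b) :
    ∀ᶠ n : ℕ in atTop, ((n : ℝ) + 1) * a ≤ n * b := by
  have : Tendsto (fun n : ℕ => (n : ℝ) * (b - a)) atTop atTop :=
    tendsto_natCast_atTop_atTop.atTop_mul_const (sub_pos.2 h)
  filter_upwards [this.eventually_ge_atTop a] with n hn
  linarith

/-- The large deviation principle of the information spectrum. -/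
theorem satisfiesLDP_infoSpectrum [Nonempty X] (hμ : μ ∈ stdSimplex ℝ X)
    (hπ : π ∈ Matrix.rowStochastic ℝ X) (hirr : π.IsIrreducible) :
    SatisfiesLDP (fun n => law (markovPmf μ π n) (infoSpectrum (markovPmf μ π n)))
      (spectrumRate π) := by
  obtain ⟨C, hC⟩ := exists_abs_infoSpectrum_sub_energy_le hμ.1 hπ.1
  have hCt : Tendsto (fun n : ℕ => C / ((n : ℝ) + 1)) atTop (𝓝 0) :=
    (tendsto_add_atTop_iff_nat (f := fun n : ℕ => C / (n : ℝ)) 1).2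
      (tendsto_const_div_atTop_nhds_zero_nat C) |>.congr fun n => by simp
  -- a word close to `Q` has its information spectrum close to `energy π Q`
  have hclose : ∀ (Q : X × X → ℝ) (ε : ℝ), 0 < ε → ∃ δ > 0, ∀ᶠ n : ℕ in atTop,
      ∀ x : Fin (n + 1) → X, 0 < markovPmf μ π (n + 1) x → dist (pairEmpirical x) Q < δ →
        dist (infoSpectrum (markovPmf μ π (n + 1)) x) (energy π Q) < ε := by
    intro Q ε hε
    obtain ⟨δ, hδ, hball⟩ := Metric.continuous_iff.1 (continuous_energy π) Q (ε / 2) (half_pos hε)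
    refine ⟨δ, hδ, ?_⟩
    filter_upwards [hCt.eventually_lt_const (half_pos hε), eventually_ne_atTop 0]
      with n h1 hn x hx hd
    have h2 := dist_triangle (infoSpectrum (markovPmf μ π (n + 1)) x)
      (energy π (pairEmpirical x)) (energy π Q)
    have h3 := hball _ hd
    have h4 := hC n hn x hx
    rw [← Real.dist_eq] at h4
    linarith
  refine SatisfiesLDP.of_real
    (fun n K => prob (markovPmf μ π n) (infoSpectrum (markovPmf μ π n) ⁻¹' K))
    (fun n K => law_apply (markovPmf_nonneg hμ.1 hπ.1 _) _ K)
    (isCompact_level_spectrumRate hπ) (fun K hK c hc c' hc' => ?_) fun U hU t htU c hc => ?_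
  · have := eventually_prob_le_exp hμ hπ.1
      (fun n => infoSpectrum (markovPmf μ π (n + 1)) ⁻¹' K) c fun Q hQ hs hcl => by
        have hQK : energy π Q ∈ K := by
          rw [← hK.closure_eq, Metric.mem_closure_iff]
          intro ε hε
          obtain ⟨δ, hδ, hev⟩ := hclose Q ε hε
          obtain ⟨n, ⟨x, hx, hpos, hd⟩, hn⟩ := ((hcl δ hδ).and_eventually hev).exists
          exact ⟨_, hx, by rw [dist_comm]; exact hn x hpos hd⟩
        have := (hc _ hQK).trans_le (EReal.coe_ennreal_le_coe_ennreal_iff.2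
          (spectrumRate_energy_le hQ hs))
        rwa [coe_levelTwoRate hπ hQ hs, EReal.coe_lt_coe_iff] at this
    rw [← map_add_atTop_eq_nat 1, eventually_map]
    filter_upwards [this, eventually_mul_succ_le hc'] with n hn h2
    refine hn.trans (Real.exp_le_exp.2 (neg_le_neg ?_))
    push_cast
    exact h2
  · have hfin : spectrumRate π t ≠ ⊤ := fun h => by simp [h] at hc
    obtain ⟨Q, hQ, hs, rfl, hle⟩ := exists_levelTwoRate_le_spectrumRate hπ hfin
    have hc := (EReal.coe_ennreal_le_coe_ennreal_iff.2 hle).trans_lt hc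
    rw [coe_levelTwoRate hπ hQ hs, EReal.coe_lt_coe_iff] at hc
    obtain ⟨c₁, h1, h2⟩ := exists_between hc
    obtain ⟨ε, hε, hball⟩ := Metric.isOpen_iff.1 hU _ htU
    obtain ⟨δ, hδ, hev⟩ := hclose Q ε hε
    rw [← map_add_atTop_eq_nat 1, eventually_map]
    filter_upwards [eventually_exp_le_prob_dist_lt hμ hπ hirr hQ hs h1 hδ, hev,
      eventually_mul_succ_le (neg_lt_neg h2)] with n hn hx h3
    calc Real.exp (-(((n + 1 : ℕ) : ℝ) * c)) ≤ Real.exp (-(n * c₁)) := by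
          refine Real.exp_le_exp.2 ?_
          push_cast
          linarith
      _ ≤ _ := hn.trans (prob_mono (markovPmf_nonneg hμ.1 hπ.1 _) fun x hxd hpos =>
          hball (hx x hpos hxd))

end LDP

/-! ### Growth rate of the sums of powers of word probabilities -/

section Growth

variable {X : Type*} [Fintype X]

lemma markovPmf_rpow {X : Type*} {μ : X → ℝ} {π : Matrix X X ℝ} (hμ : 0 ≤ μ) (hπ : ∀ a b, 0 ≤ π a b)
    (α : ℝ) (n : ℕ) (x : Fin n → X) :
    markovPmf μ π n x ^ α
      = markovPmf (fun a => μ a ^ α) (Matrix.of fun a b => π a b ^ α) n x := by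
  cases n with
  | zero => simp [markovPmf]
  | succ n =>
    rw [markovPmf, markovPmf, Real.mul_rpow (hμ _) (Finset.prod_nonneg fun i _ => hπ _ _),
      ← Real.finsetProd_rpow _ _ fun i _ => hπ _ _]
    rfl

/-- Path sums of a nonnegative matrix with a positive eigenvector for the eigenvalue `r` lie
between constant multiples of `r ^ n`. -/
lemma tendsto_log_sum_markovPmf [Nonempty X] {A : Matrix X X ℝ} {v m : X → ℝ} {r : ℝ} (hr : 0 < r)
    (hv : ∀ a, 0 < v a) (hA : ∀ a b, 0 ≤ A a b) (hAv : A.mulVec v = r • v) (hm : 0 ≤ m)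
    (hm0 : m ≠ 0) :
    (∀ᶠ n : ℕ in atTop, 0 < ∑ x : Fin n → X, markovPmf m A n x) ∧
    Tendsto (fun n : ℕ => (1 / (n : ℝ)) * Real.log (∑ x : Fin n → X, markovPmf m A n x)) atTop
      (𝓝 (Real.log r)) := by
  obtain ⟨a₀, ha₀⟩ := Finite.exists_min v
  obtain ⟨a₁, ha₁⟩ := Finite.exists_max v
  set s := ∑ a, m a * v a with hs
  have hspos : 0 < s := by
    obtain ⟨a, ha⟩ := Function.ne_iff.1 hm0
    exact Finset.sum_pos' (fun b _ => mul_nonneg (hm b) (hv b).le)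
      ⟨a, Finset.mem_univ a, mul_pos (lt_of_le_of_ne (hm a) (Ne.symm ha)) (hv a)⟩
  have hnn := fun n (x : Fin (n + 1) → X) => markovPmf_nonneg hm hA (n + 1) x
  have hlow : ∀ n : ℕ, s / v a₁ * r ^ n ≤ ∑ x : Fin (n + 1) → X, markovPmf m A (n + 1) x := by
    intro n
    rw [div_mul_eq_mul_div, div_le_iff₀ (hv a₁), mul_comm s, hs,
      ← sum_markovPmf_mul_eigenvector hAv n m, Finset.sum_mul]
    exact Finset.sum_le_sum fun x _ => mul_le_mul_of_nonneg_left (ha₁ _) (hnn n x)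
  have hup : ∀ n : ℕ, ∑ x : Fin (n + 1) → X, markovPmf m A (n + 1) x ≤ s / v a₀ * r ^ n := by
    intro n
    rw [div_mul_eq_mul_div, le_div_iff₀ (hv a₀), mul_comm s, hs,
      ← sum_markovPmf_mul_eigenvector hAv n m, Finset.sum_mul]
    exact Finset.sum_le_sum fun x _ => mul_le_mul_of_nonneg_left (ha₀ _) (hnn n x)
  have hc₁ : 0 < s / v a₁ := div_pos hspos (hv a₁)
  have hc₀ : 0 < s / v a₀ := div_pos hspos (hv a₀)
  have hpos : ∀ n : ℕ, 0 < ∑ x : Fin (n + 1) → X, markovPmf m A (n + 1) x := fun n =>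
    (mul_pos hc₁ (pow_pos hr n)).trans_le (hlow n)
  refine ⟨by rw [← map_add_atTop_eq_nat 1, eventually_map]; exact Eventually.of_forall hpos, ?_⟩
  rw [← tendsto_add_atTop_iff_nat 1]
  have hlim : ∀ c : ℝ, Tendsto (fun n : ℕ => 1 / (((n + 1 : ℕ) : ℝ)) * (c + n * Real.log r)) atTop
      (𝓝 (Real.log r)) := fun c => by
    have h1 : Tendsto (fun n : ℕ => (c - Real.log r) * (1 / ((n : ℝ) + 1)) + Real.log r) atTop
        (𝓝 ((c - Real.log r) * 0 + Real.log r)) :=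
      (tendsto_one_div_add_atTop_nhds_zero_nat.const_mul _).add_const _
    rw [mul_zero, zero_add] at h1
    refine h1.congr fun n => ?_
    have : (n : ℝ) + 1 ≠ 0 := by positivity
    push_cast
    field_simp
    ring
  refine tendsto_of_tendsto_of_tendsto_of_le_of_le (hlim (Real.log (s / v a₁)))
    (hlim (Real.log (s / v a₀))) (fun n => ?_) fun n => ?_
  · refine mul_le_mul_of_nonneg_left ?_ (by positivity)
    rw [← Real.log_pow, ← Real.log_mul hc₁.ne' (pow_pos hr n).ne']
    exact Real.log_le_log (mul_pos hc₁ (pow_pos hr n)) (hlow n)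
  · refine mul_le_mul_of_nonneg_left ?_ (by positivity)
    rw [← Real.log_pow, ← Real.log_mul hc₀.ne' (pow_pos hr n).ne']
    exact Real.log_le_log (hpos n) (hup n)

end Growth

/-! ### Moments of optimal guessing functions -/

section Guessing

variable {A : Type*} [Fintype A] {P : A → ℝ} {G : A → ℕ}

lemma IsOptimalGuessing.one_le (hG : IsOptimalGuessing P G) (a : A) : 1 ≤ G a :=
  (hG.1.mapsTo (Set.mem_univ a)).1

open Classical in
/-- All guesses up to the correct one are at least as probable as the correct one. -/
lemma IsOptimalGuessing.le_card (hG : IsOptimalGuessing P G) (a : A) :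
    G a ≤ (Finset.univ.filter fun b => P a ≤ P b).card := by
  have hsub : Finset.Icc 1 (G a) ⊆ (Finset.univ.filter fun b => P a ≤ P b).image G := by
    intro k hk
    rw [Finset.mem_Icc] at hk
    obtain ⟨b, -, rfl⟩ := hG.1.surjOn
      ⟨hk.1, hk.2.trans (hG.1.mapsTo (Set.mem_univ a)).2⟩
    refine Finset.mem_image.2 ⟨b, Finset.mem_filter.2 ⟨Finset.mem_univ b, ?_⟩, rfl⟩
    by_contra hlt
    exact absurd (hG.2 a b (not_le.1 hlt)) (not_lt.2 hk.2)
  simpa using (Finset.card_le_card hsub).trans Finset.card_image_le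

/-- Arikan's upper bound: the number of `b` with `P b ≥ P a` is at most `∑ (P b / P a) ^ α`. -/
lemma IsOptimalGuessing.sum_mul_rpow_le (hP : 0 ≤ P) (hG : IsOptimalGuessing P G) {ρ : ℝ}
    (hρ : 0 < ρ) :
    ∑ a, P a * (G a : ℝ) ^ ρ ≤ (∑ a, P a ^ (1 / (1 + ρ))) ^ (1 + ρ) := by
  classical
  set α := 1 / (1 + ρ) with hα
  set S := ∑ a, P a ^ α with hS
  have hαpos : 0 < α := by positivity
  have hS0 : 0 ≤ S := Finset.sum_nonneg fun a _ => Real.rpow_nonneg (hP a) _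
  have hterm : ∀ a, P a * (G a : ℝ) ^ ρ ≤ S ^ ρ * P a ^ α := by
    intro a
    rcases (hP a).eq_or_lt with h | h
    · have h : P a = 0 := h.symm
      rw [h, zero_mul]
      positivity
    have h : 0 < P a := h
    have hGa : (G a : ℝ) ≤ S * P a ^ (-α) := by
      calc (G a : ℝ) ≤ ((Finset.univ.filter fun b => P a ≤ P b).card : ℝ) := by
            exact_mod_cast hG.le_card a
        _ = ∑ b, if P a ≤ P b then (1 : ℝ) else 0 := by simp
        _ ≤ ∑ b, P b ^ α * P a ^ (-α) := by
            refine Finset.sum_le_sum fun b _ => ?_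
            split_ifs with hab
            · rw [Real.rpow_neg h.le, ← div_eq_mul_inv, one_le_div (Real.rpow_pos_of_pos h _)]
              exact Real.rpow_le_rpow h.le hab hαpos.le
            · exact mul_nonneg (Real.rpow_nonneg (hP b) _) (Real.rpow_nonneg h.le _)
        _ = S * P a ^ (-α) := by rw [hS, Finset.sum_mul]
    calc P a * (G a : ℝ) ^ ρ ≤ P a * (S * P a ^ (-α)) ^ ρ := by gcongr
      _ = S ^ ρ * (P a ^ (1 : ℝ) * P a ^ (-α * ρ)) := by
          rw [Real.mul_rpow hS0 (Real.rpow_nonneg h.le _), ← Real.rpow_mul h.le, Real.rpow_one]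
          ring
      _ = S ^ ρ * P a ^ α := by
          rw [← Real.rpow_add h]
          congr 2
          rw [hα]
          field_simp
          ring
  calc ∑ a, P a * (G a : ℝ) ^ ρ ≤ ∑ a, S ^ ρ * P a ^ α := Finset.sum_le_sum fun a _ => hterm a
    _ = S ^ ρ * S := by rw [← Finset.mul_sum]
    _ = S ^ (1 + ρ) := by
        rw [Real.rpow_add_of_nonneg hS0 zero_le_one hρ.le, Real.rpow_one, mul_comm]

lemma IsOptimalGuessing.sum_inv_le [Nonempty A] (hG : IsOptimalGuessing P G) :
    ∑ a, (G a : ℝ)⁻¹ ≤ 1 + Real.log (Fintype.card A) := by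
  have h : ∑ a, (G a : ℝ)⁻¹ = ∑ k ∈ Finset.Icc 1 (Fintype.card A), (k : ℝ)⁻¹ :=
    Finset.sum_nbij G (fun a _ => by simpa using hG.1.mapsTo (Set.mem_univ a))
      (by simpa using hG.1.injOn) (by simpa using hG.1.surjOn) fun a _ => rfl
  rw [h]
  have := harmonic_le_one_add_log (Fintype.card A)
  rw [harmonic_eq_sum_Icc] at this
  simpa using this

/-- Arikan's lower bound: Hölder's inequality applied to
`P ^ α = (P G ^ ρ) ^ α · (1 / G) ^ (ρ α)`. -/
lemma IsOptimalGuessing.le_sum_mul_rpow [Nonempty A] (hP : 0 ≤ P) (hG : IsOptimalGuessing P G)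
    {ρ : ℝ} (hρ : 0 < ρ) :
    (∑ a, P a ^ (1 / (1 + ρ))) ^ (1 + ρ)
      ≤ (∑ a, P a * (G a : ℝ) ^ ρ) * (1 + Real.log (Fintype.card A)) ^ ρ := by
  have hG0 : ∀ a, (0 : ℝ) < G a := fun a => by exact_mod_cast hG.one_le a
  have h1ρ : 0 < 1 + ρ := by linarith
  have hpq : (1 + ρ).HolderConjugate ((1 + ρ) / ρ) := by
    rw [Real.holderConjugate_iff]
    refine ⟨by linarith, ?_⟩
    field_simp
  have hE0 : 0 ≤ ∑ a, P a * (G a : ℝ) ^ ρ :=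
    Finset.sum_nonneg fun a _ => mul_nonneg (hP a) (Real.rpow_nonneg (hG0 a).le _)
  have hH0 : 0 ≤ ∑ a, (G a : ℝ)⁻¹ := Finset.sum_nonneg fun a _ => (inv_pos.2 (hG0 a)).le
  have hE : ∀ a, 0 ≤ P a * (G a : ℝ) ^ ρ := fun a =>
    mul_nonneg (hP a) (Real.rpow_nonneg (hG0 a).le _)
  have holder := Real.inner_le_Lp_mul_Lq_of_nonneg Finset.univ hpq
    (f := fun a => (P a * (G a : ℝ) ^ ρ) ^ (1 / (1 + ρ)))
    (g := fun a => ((G a : ℝ)⁻¹) ^ (ρ / (1 + ρ)))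
    (fun a _ => Real.rpow_nonneg (hE a) _)
    (fun a _ => Real.rpow_nonneg (inv_pos.2 (hG0 a)).le _)
  have e1 : ∀ a, (P a * (G a : ℝ) ^ ρ) ^ (1 / (1 + ρ)) * ((G a : ℝ)⁻¹) ^ (ρ / (1 + ρ))
      = P a ^ (1 / (1 + ρ)) := fun a => by
    rw [Real.mul_rpow (hP a) (Real.rpow_nonneg (hG0 a).le _), ← Real.rpow_mul (hG0 a).le,
      Real.inv_rpow (hG0 a).le, mul_one_div, mul_assoc,
      mul_inv_cancel₀ (Real.rpow_pos_of_pos (hG0 a) _).ne', mul_one]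
  have e2 : ∀ a, ((P a * (G a : ℝ) ^ ρ) ^ (1 / (1 + ρ))) ^ (1 + ρ) = P a * (G a : ℝ) ^ ρ :=
    fun a => by
      rw [← Real.rpow_mul (hE a), one_div_mul_cancel h1ρ.ne', Real.rpow_one]
  have e3 : ∀ a, (((G a : ℝ)⁻¹) ^ (ρ / (1 + ρ))) ^ ((1 + ρ) / ρ) = (G a : ℝ)⁻¹ := fun a => by
    rw [← Real.rpow_mul (inv_pos.2 (hG0 a)).le]
    have : ρ / (1 + ρ) * ((1 + ρ) / ρ) = 1 := by field_simp
    rw [this, Real.rpow_one]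
  simp only [e1, e2, e3] at holder
  calc _ ≤ ((∑ a, P a * (G a : ℝ) ^ ρ) ^ (1 / (1 + ρ))
        * (∑ a, (G a : ℝ)⁻¹) ^ (1 / ((1 + ρ) / ρ))) ^ (1 + ρ) :=
        Real.rpow_le_rpow (Finset.sum_nonneg fun a _ => Real.rpow_nonneg (hP a) _) holder h1ρ.le
    _ = (∑ a, P a * (G a : ℝ) ^ ρ) * (∑ a, (G a : ℝ)⁻¹) ^ ρ := by
        rw [Real.mul_rpow (Real.rpow_nonneg hE0 _) (Real.rpow_nonneg hH0 _),
          ← Real.rpow_mul hE0, ← Real.rpow_mul hH0, one_div_mul_cancel h1ρ.ne', Real.rpow_one]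
        congr 2
        field_simp
    _ ≤ _ := by
        gcongr
        exact hG.sum_inv_le

end Guessing

lemma tendsto_one_div_mul_log_one_add (K : ℝ) (hK : 0 ≤ K) :
    Tendsto (fun n : ℕ => 1 / (n : ℝ) * Real.log (1 + n * K)) atTop (𝓝 0) := by
  have h0 : Tendsto (fun n : ℕ => Real.log ((n : ℝ) * (1 + K)) / (n : ℝ)) atTop (𝓝 0) := by
    have h1 : Tendsto (fun n : ℕ => Real.log (n : ℝ) / (n : ℝ)) atTop (𝓝 0) := by
      have := (Real.isLittleO_log_id_atTop.tendsto_div_nhds_zero).comp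
        (tendsto_natCast_atTop_atTop (R := ℝ))
      simpa [Function.comp_def] using this
    have h2 := h1.add (tendsto_const_div_atTop_nhds_zero_nat (Real.log (1 + K)))
    rw [add_zero] at h2
    refine h2.congr' ?_
    filter_upwards [eventually_gt_atTop 0] with n hn
    rw [Real.log_mul (by positivity) (by positivity), add_div]
  refine squeeze_zero' (Eventually.of_forall fun n => ?_) ?_ h0
  · exact mul_nonneg (by positivity) (Real.log_nonneg (le_add_of_nonneg_right (by positivity)))
  · filter_upwards [eventually_ge_atTop 1] with n hn
    have hn' : (1 : ℝ) ≤ n := by exact_mod_cast hn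
    rw [one_div_mul_eq_div]
    gcongr
    nlinarith

/-- By Arikan's bounds, the guessing exponent of a sequence of pmfs on words is determined by the
growth of `∑ P ^ (1 / (1 + ρ))`, because `ln (1 + n ln |X|) = o(n)`. -/
theorem tendsto_guessingExponent {X : Type*} [Fintype X] [Nonempty X]
    {P : (n : ℕ) → (Fin n → X) → ℝ} (hP : ∀ n, 0 ≤ P n) {ρ L : ℝ} (hρ : 0 < ρ)
    (hpos : ∀ᶠ n : ℕ in atTop, 0 < ∑ x : Fin n → X, P n x ^ (1 / (1 + ρ)))
    (hL : Tendsto (fun n : ℕ => (1 / (n : ℝ)) * Real.log (∑ x : Fin n → X, P n x ^ (1 / (1 + ρ))))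
      atTop (𝓝 L))
    {G : (n : ℕ) → (Fin n → X) → ℕ} (hG : ∀ n, IsOptimalGuessing (P n) (G n)) :
    Tendsto (fun n : ℕ => (1 / (n : ℝ)) * Real.log (∑ x : Fin n → X, P n x * (G n x : ℝ) ^ ρ))
      atTop (𝓝 ((1 + ρ) * L)) := by
  have hK : 0 ≤ Real.log (Fintype.card X) :=
    Real.log_nonneg (by exact_mod_cast Fintype.card_pos)
  have hlow := (hL.const_mul (1 + ρ)).sub
    ((tendsto_one_div_mul_log_one_add _ hK).const_mul ρ)
  rw [mul_zero, sub_zero] at hlow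
  have hcard : ∀ n : ℕ, Real.log (Fintype.card (Fin n → X)) = n * Real.log (Fintype.card X) :=
    fun n => by rw [Fintype.card_fun, Fintype.card_fin, Nat.cast_pow, Real.log_pow]
  have hbounds : ∀ᶠ n : ℕ in atTop,
      (1 + ρ) * Real.log (∑ x : Fin n → X, P n x ^ (1 / (1 + ρ)))
        - ρ * Real.log (1 + n * Real.log (Fintype.card X))
        ≤ Real.log (∑ x : Fin n → X, P n x * (G n x : ℝ) ^ ρ) ∧
      Real.log (∑ x : Fin n → X, P n x * (G n x : ℝ) ^ ρ)
        ≤ (1 + ρ) * Real.log (∑ x : Fin n → X, P n x ^ (1 / (1 + ρ))) := by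
    filter_upwards [hpos] with n hS
    have h1 := (hG n).sum_mul_rpow_le (hP n) hρ
    have h2 := (hG n).le_sum_mul_rpow (hP n) hρ
    rw [hcard] at h2
    have hD : 0 < 1 + n * Real.log (Fintype.card X) :=
      add_pos_of_pos_of_nonneg one_pos (by positivity)
    have hDρ := Real.rpow_pos_of_pos hD ρ
    have hSρ := Real.rpow_pos_of_pos hS (1 + ρ)
    have hE : 0 < ∑ x : Fin n → X, P n x * (G n x : ℝ) ^ ρ :=
      (pos_iff_pos_of_mul_pos (hSρ.trans_le h2)).2 hDρ
    constructor
    · have h3 := Real.log_le_log hSρ h2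
      rw [Real.log_mul hE.ne' hDρ.ne', Real.log_rpow hS, Real.log_rpow hD] at h3
      linarith
    · have h3 := Real.log_le_log hE h1
      rwa [Real.log_rpow hS] at h3
  refine tendsto_of_tendsto_of_tendsto_of_le_of_le' hlow (hL.const_mul (1 + ρ)) ?_ ?_
  · filter_upwards [hbounds] with n hn
    have := mul_le_mul_of_nonneg_left hn.1 (by positivity : (0 : ℝ) ≤ 1 / n)
    linarith
  · filter_upwards [hbounds] with n hn
    have := mul_le_mul_of_nonneg_left hn.2 (by positivity : (0 : ℝ) ≤ 1 / n)
    linarith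

/-- The exponential moment of the information spectrum is a sum of powers of probabilities. -/
lemma mul_exp_infoSpectrum {X : Type*} {n : ℕ} (hn : n ≠ 0) {P : (Fin n → X) → ℝ} (hP : 0 ≤ P)
    {ρ : ℝ} (hρ : 0 < ρ) (x : Fin n → X) :
    P x * Real.exp (n * (ρ / (1 + ρ)) * infoSpectrum P x) = P x ^ (1 / (1 + ρ)) := by
  rcases (hP x).eq_or_lt with h | h
  · have h : P x = 0 := h.symm
    rw [h, zero_mul, Real.zero_rpow (by positivity)]
  have h : 0 < P x := h
  have hn' : (n : ℝ) ≠ 0 := by exact_mod_cast hn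
  nth_rw 1 [← Real.exp_log h]
  rw [← Real.exp_add, Real.rpow_def_of_pos h, infoSpectrum]
  congr 1
  field_simp
  ring

/-! ### Variational formulas -/

section Variational

variable {X : Type*} [Fintype X] [DecidableEq X] {π : Matrix X X ℝ} {ρ r : ℝ} {v w : X → ℝ}

/-- The affine relations between the functionals in the two variational formulas. -/
lemma dual_identities (hρ : 0 < ρ) (H F : ℝ) :
    ρ / (1 + ρ) * F - (F - H) = H - 1 / (1 + ρ) * F ∧
      ρ * H - (F - H) = (1 + ρ) * (H - 1 / (1 + ρ) * F) := by
  have : 1 + ρ ≠ 0 := by positivity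
  constructor <;> field_simp <;> ring

theorem iSup_sub_spectrumRate [Nonempty X] (hπ : π ∈ Matrix.rowStochastic ℝ X) (hρ : 0 < ρ)
    (hr : 0 < r) (hv : ∀ i, 0 < v i) (hw : ∀ i, 0 < w i)
    (hAv : (Matrix.of fun a b => π a b ^ (1 / (1 + ρ))).mulVec v = r • v)
    (hwA : Matrix.vecMul w (Matrix.of fun a b => π a b ^ (1 / (1 + ρ))) = r • w) :
    (⨆ t : ℝ, ((ρ / (1 + ρ) * t : ℝ) : EReal) - (spectrumRate π t : EReal))
      = (Real.log r : EReal) := by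
  have hα : 1 / (1 + ρ) ≠ 0 := by positivity
  refine le_antisymm (iSup_le fun t => ?_) ?_
  · by_cases ht : spectrumRate π t = ⊤
    · simp [ht]
    obtain ⟨Q, hQ, hs, rfl, hle⟩ := exists_levelTwoRate_le_spectrumRate hπ ht
    refine (EReal.sub_le_sub le_rfl (EReal.coe_ennreal_le_coe_ennreal_iff.2 hle)).trans ?_
    rw [coe_levelTwoRate hπ hQ hs, ← EReal.coe_sub, EReal.coe_le_coe_iff,
      pairRate_eq_energy_sub_condEntropy π hQ.1.1, (dual_identities hρ _ _).1]
    exact condEntropy_sub_energy_le hr hv hα hπ.1 hAv hQ hs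
  · set Q := tiltedPair (Matrix.of fun a b => π a b ^ (1 / (1 + ρ))) r v w with hQdef
    have hs : IsSupported π Q := isSupported_tiltedPair_rpow hα r v w
    have hQ : Q ∈ stationaryPairs X :=
      tiltedPair_mem_stationaryPairs (fun a b => Real.rpow_nonneg (hπ.1 a b) _) hr hv hw hAv hwA
    have heq := condEntropy_sub_energy_tiltedPair hr hv hw hα hπ.1 hAv hwA
    refine le_trans ?_ (le_iSup _ (energy π Q))
    refine le_trans ?_ (EReal.sub_le_sub le_rfl
      (EReal.coe_ennreal_le_coe_ennreal_iff.2 (spectrumRate_energy_le hQ hs)))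
    rw [coe_levelTwoRate hπ hQ hs, ← EReal.coe_sub, EReal.coe_le_coe_iff,
      pairRate_eq_energy_sub_condEntropy π hQ.1.1, (dual_identities hρ _ _).1]
    exact heq.ge

theorem iSup_condEntropy_sub_condRelEntropy [Nonempty X] (hπ : π ∈ Matrix.rowStochastic ℝ X)
    (hρ : 0 < ρ) (hr : 0 < r) (hv : ∀ i, 0 < v i) (hw : ∀ i, 0 < w i)
    (hAv : (Matrix.of fun a b => π a b ^ (1 / (1 + ρ))).mulVec v = r • v)
    (hwA : Matrix.vecMul w (Matrix.of fun a b => π a b ^ (1 / (1 + ρ))) = r • w) :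
    (⨆ Q ∈ stationaryPairs X, ((ρ * condEntropy Q : ℝ) : EReal) - (condRelEntropy π Q : EReal))
      = (((1 + ρ) * Real.log r : ℝ) : EReal) := by
  have hα : 1 / (1 + ρ) ≠ 0 := by positivity
  have hval : ∀ Q ∈ stationaryPairs X, IsSupported π Q →
      ((ρ * condEntropy Q : ℝ) : EReal) - (condRelEntropy π Q : EReal)
        = (((1 + ρ) * (condEntropy Q - 1 / (1 + ρ) * energy π Q) : ℝ) : EReal) := by
    intro Q hQ hs
    have h := coe_levelTwoRate hπ hQ hs
    rw [levelTwoRate, if_pos hQ] at h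
    rw [h, ← EReal.coe_sub, pairRate_eq_energy_sub_condEntropy π hQ.1.1,
      (dual_identities hρ _ _).2]
  refine le_antisymm (iSup₂_le fun Q hQ => ?_) ?_
  · by_cases hs : IsSupported π Q
    · rw [hval Q hQ hs, EReal.coe_le_coe_iff]
      exact mul_le_mul_of_nonneg_left
        (condEntropy_sub_energy_le hr hv hα hπ.1 hAv hQ hs) (by positivity)
    · simp [condRelEntropy_eq_top hQ.1.1 hs]
  · have hs : IsSupported π (tiltedPair (Matrix.of fun a b => π a b ^ (1 / (1 + ρ))) r v w) :=
      isSupported_tiltedPair_rpow hα r v w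
    have hQ : tiltedPair (Matrix.of fun a b => π a b ^ (1 / (1 + ρ))) r v w ∈ stationaryPairs X :=
      tiltedPair_mem_stationaryPairs (fun a b => Real.rpow_nonneg (hπ.1 a b) _) hr hv hw hAv hwA
    refine le_trans ?_ (le_iSup₂ _ hQ)
    rw [hval _ hQ hs, condEntropy_sub_energy_tiltedPair hr hv hw hα hπ.1 hAv hwA]

end Variational

end MarkovGuessing

theorem mainTheorem8 {X : Type*} [Fintype X] [DecidableEq X]
    (π : Matrix X X ℝ) (hπ : π ∈ Matrix.rowStochastic ℝ X) (hirr : π.IsIrreducible)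
    (μ : X → ℝ) (hμ : μ ∈ stdSimplex ℝ X) :
    -- level-2 LDP of the empirical pair measure of `n` transitions
    SatisfiesLDP (fun n => law (markovPmf μ π (n + 1)) pairEmpirical) (levelTwoRate π) ∧
    -- LDP of the information spectrum
    SatisfiesLDP (fun n => law (markovPmf μ π n) (infoSpectrum (markovPmf μ π n)))
      (spectrumRate π) ∧
    ∀ ρ : ℝ, 0 < ρ →
      ∃ lam : ℝ, 0 < lam ∧
        IsPerronFrobeniusEigenvalue
          (Matrix.of fun x₁ x₂ => (π x₁ x₂) ^ (1 / (1 + ρ)) : Matrix X X ℝ) lam ∧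
        -- limiting cumulant of the information spectrum at `β = ρ / (1 + ρ)`
        Tendsto (fun n : ℕ => (1 / (n : ℝ)) * Real.log (∑ x : Fin n → X,
            markovPmf μ π n x *
              Real.exp (n * (ρ / (1 + ρ)) * infoSpectrum (markovPmf μ π n) x)))
          atTop (𝓝 (Real.log lam)) ∧
        -- the cumulant is the Legendre–Fenchel dual of the rate function at `β`
        (⨆ t : ℝ, ((ρ / (1 + ρ) * t : ℝ) : EReal) - (spectrumRate π t : EReal))
          = (Real.log lam : EReal) ∧
        -- the limiting guessing exponent exists and equals `(1 + ρ) ln λ`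
        (∀ G : (n : ℕ) → (Fin n → X) → ℕ,
          (∀ n, IsOptimalGuessing (markovPmf μ π n) (G n)) →
          Tendsto (fun n : ℕ => (1 / (n : ℝ)) * Real.log (∑ x : Fin n → X,
              markovPmf μ π n x * (G n x : ℝ) ^ ρ))
            atTop (𝓝 ((1 + ρ) * Real.log lam))) ∧
        -- variational formula
        (((1 + ρ) * Real.log lam : ℝ) : EReal)
          = ⨆ Q ∈ stationaryPairs X,
              ((ρ * condEntropy Q : ℝ) : EReal) - (condRelEntropy π Q : EReal) := by
  have hne : Nonempty X := by
    by_contra hempty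
    rw [not_nonempty_iff] at hempty
    simpa using hμ.2
  refine ⟨satisfiesLDP_pairEmpirical hμ hπ hirr, satisfiesLDP_infoSpectrum hμ hπ hirr,
    fun ρ hρ => ?_⟩
  have hα : 1 / (1 + ρ) ≠ 0 := by positivity
  set A : Matrix X X ℝ := Matrix.of fun x₁ x₂ => (π x₁ x₂) ^ (1 / (1 + ρ)) with hAdef
  have hA0 : ∀ a b, 0 ≤ A a b := fun a b => Real.rpow_nonneg (hπ.1 a b) _
  have hA : A.IsIrreducible :=
    isIrreducible_of_pos hirr hA0 fun a b h => Real.rpow_pos_of_pos h _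
  obtain ⟨r, v, w, hr, hv, hw, hAv, hwA⟩ := exists_pos_eigenvectors hA
  have hP0 : ∀ n, 0 ≤ markovPmf μ π n := markovPmf_nonneg hμ.1 hπ.1
  have hm0 : (fun a => μ a ^ (1 / (1 + ρ))) ≠ 0 := fun h => by
    have : ∀ a, μ a = 0 := fun a => (Real.rpow_eq_zero (hμ.1 a) hα).1 (congrFun h a)
    simpa [this] using hμ.2
  obtain ⟨hpos, hlim⟩ := tendsto_log_sum_markovPmf hr hv hA0 hAv
    (m := fun a => μ a ^ (1 / (1 + ρ))) (fun a => Real.rpow_nonneg (hμ.1 a) _) hm0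
  simp only [hAdef, ← markovPmf_rpow hμ.1 hπ.1] at hpos hlim
  refine ⟨r, hr, isPerronFrobeniusEigenvalue_of_pos hA hv hw hAv hwA, hlim.congr' ?_,
    iSup_sub_spectrumRate hπ hρ hr hv hw hAv hwA,
    fun G hG => tendsto_guessingExponent hP0 hρ hpos hlim hG,
    (iSup_condEntropy_sub_condRelEntropy hπ hρ hr hv hw hAv hwA).symm⟩
  filter_upwards [eventually_ne_atTop 0] with n hn
  simp only [mul_exp_infoSpectrum hn (hP0 n) hρ]
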